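/- For $x\in\mathbb Z^n$ let $a_1,\dots,a_n$ be the coordinates of $x$ rearranged so that $|a_1|\ge\dots\ge|a_n|$, put $a_i=0$ for $i>n$, and let $\|x_{-j}\|_2^2=\sum_{i>j}a_i^2$ be the squared Euclidean norm of $x$ without its top $j$ coordinates. Let $k=k(x)$ be the largest integer with $|a_k|\ge k$ (with $k=0$ for $x=0$). A (randomized, integer) linear sketch draws a uniformly random seed, which determines an integer matrix $S$; it stores the seed and the vector $Sx$, and computes its output from these alone. Its space is the number of bits of the seed plus the number of bits used for $Sx$, where all entries of $Sx$ must fit into the words reserved for them for every $x$ with $\|x\|_\infty\le m$ and every seed. For every constant $c\in\mathbb R$ there is an exponent $d$ such that for all constants $\gamma\in\mathbb N$ and $\delta\in(0,1)$ there is a constant $K$ with the following property. For all $n\ge2$, $m\le n^\gamma$, $\varepsilon\in(0,1)$ and $0\le p\le2$ there is a linear sketch that uses at most $K(\log_2 n/\varepsilon)^d$ bits of space and such that, for every $x\in\mathbb Z^n$ with $\|x\|_\infty\le m$ that satisfies $$a_{\lfloor(1+\varepsilon)k\rfloor}^2\;\ge\;\Big(\frac{\varepsilon}{\log_2 n}\Big)^{c}\cdot\frac{\|x_{-\lfloor(1+\varepsilon)k\rfloor}\|_2^2}{(1+\varepsilon)k}$$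 (a condition that is regarded as satisfied if $x=0$), the output $Z$ of the sketch on $x$ satisfies, with probability at least $1-\delta$, $$\Big|Z-\sum_{i=1}^k|a_i|^p\Big|\;\le\;\varepsilon\sum_{i=1}^k|a_i|^p .$$ -/

import Mathlib

namespace TrimmedSketch

/-- A randomized linear sketch of integer vectors of dimension `n`. A uniformly random seed of
`seedBits` bits determines an integer matrix `S` with `rows` rows; the sketch of `x` is the integer
vector `S x`, each entry of which is kept in a word of `wordBits` bits. The output is computed by
`decode` from the seed and `S x` only. -/
structure LinearSketch (n : ℕ) where
  seedBits : ℕ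
  rows : ℕ
  wordBits : ℕ
  matrix : (Fin seedBits → Bool) → Matrix (Fin rows) (Fin n) ℤ
  decode : (Fin seedBits → Bool) → (Fin rows → ℤ) → ℝ

namespace LinearSketch

variable {n : ℕ}

/-- The number of bits that are stored: the random seed and one word for each row. -/
def space (S : LinearSketch n) : ℕ := S.seedBits + S.rows * S.wordBits

/-- No word ever overflows on inputs whose coordinates are bounded by `m` in absolute value: each
entry of the sketch is a signed integer of `wordBits` bits, whatever the seed is. -/
def FitsOn (S : LinearSketch n) (m : ℕ) : Prop :=
  ∀ (s : Fin S.seedBits → Bool) (x : Fin n → ℤ), (∀ i, |x i| ≤ (m : ℤ)) →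
    ∀ j, 2 * |(S.matrix s).mulVec x j| < 2 ^ S.wordBits

/-- The output of the sketch on input `x` with random seed `s`. -/
def output (S : LinearSketch n) (x : Fin n → ℤ) (s : Fin S.seedBits → Bool) : ℝ :=
  S.decode s ((S.matrix s).mulVec x)

/-- The probability, over a uniformly random seed, that the output on input `x` is a
`(1 ± ε)`-approximation of `v`. -/
noncomputable def successProb (S : LinearSketch n) (x : Fin n → ℤ) (ε v : ℝ) : ℝ :=
  (Nat.card {s : Fin S.seedBits → Bool // |S.output x s - v| ≤ ε * v} : ℝ) / 2 ^ S.seedBits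

end LinearSketch

/-- `sorted x i` is `a_i`, where `a_1, …, a_n` are the coordinates of `x` rearranged in
non-increasing order of absolute value (indices start at `1`; the value is `0` at indices outside
`1, …, n`). -/
def sorted {n : ℕ} (x : Fin n → ℤ) (i : ℕ) : ℤ :=
  if h : 1 ≤ i ∧ i ≤ n then x (Tuple.sort (fun j => -|x j|) ⟨i - 1, by omega⟩) else 0

/-- `‖x_{-k}‖₂²`, the squared Euclidean norm of `x` without its `k` coordinates of largest absolute
value. -/
def residualSq {n : ℕ} (x : Fin n → ℤ) (k : ℕ) : ℤ :=
  ∑ i ∈ Finset.Ioc k n, sorted x i ^ 2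

/-- `∑_{i ≤ k} |a_i|^p`, the `F_p` moment of the top `k` coordinates. -/
noncomputable def topMoment {n : ℕ} (x : Fin n → ℤ) (p : ℝ) (k : ℕ) : ℝ :=
  ∑ i ∈ Finset.Icc 1 k, |(sorted x i : ℝ)| ^ p

/-- `k` is the largest integer with `|a_k| ≥ k` (`k = 0` exactly for the zero vector). -/
def IsIndex {n : ℕ} (x : Fin n → ℤ) (k : ℕ) : Prop :=
  IsGreatest {j : ℕ | (j : ℤ) ≤ |sorted x j|} k

end TrimmedSketch

namespace TrimmedSketch
open Finset

/-! Only the non-increasing sequence b of squared sorted coordinates matters: k is where b crosses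
the squares of the ranks, and the moment is the sum of b_i^(p/2) over i ≤ k. The sketch hashes
signed coordinates into buckets at every sampling rate 2^(-ℓ), with pairwise independent hashing and
four-wise independent signs. With high probability the sampled ones among the top J coordinates are
alone among themselves and the noise of the rest is a small multiple of the tail after J, divided by
J. Large buckets then count large sampled coordinates, so the t-th largest bucket at level ℓ locates
b near rank t·2^ℓ: exactly at level 0, and up to a sampling window at higher levels.

The decoder takes any vector that satisfies the tail condition and is consistent with all bucket
values, and outputs its moment. It therefore suffices that two vectors consistent with the same
values have nearly equal moments. By pigeonhole on buckets (`Agrees.le`, `Consistent.dominated`),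
b_j ≤ (1 + 1/M) b'_{j - ⌊j/M⌋} plus η/j times the two tails after 2j, and symmetrically.

The rest is deterministic. The errors η/j have a small harmonic sum, so the tails are comparable
(`Dominated.tail_le`). The tail condition makes the error at rank k' small relative to b'_{k'}, so
the indices agree up to 1 + 4/M (`Dominated.index_le`). For the moments (`Dominated.moment_le`),
shifting ranks costs 1 + 2/M, and an additive error is either absorbed into its main term or has
(p/2)-th power at most a small multiple of the moment divided by j, which again sums harmonically.

With Λ = ⌈log₂ n / ε⌉ and M = 32Λ all parameters are polynomial in Λ. Taking J proportional to 2^ℓ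
makes the failure bounds for isolation independent of the level, since two coordinates are both
sampled with probability 4^(-ℓ). -/

/-! ### Reindexing monotone sequences. -/

theorem sub_div_pos {M j : ℕ} (hM : 2 ≤ M) (hj : 1 ≤ j) : 1 ≤ j - j / M := by
  have : j / M < j := Nat.div_lt_self hj hM
  omega

theorem le_mul_sub_div {M : ℕ} (hM : 2 ≤ M) (j : ℕ) :
    (j : ℝ) ≤ (1 + 2 / M) * ((j - j / M : ℕ) : ℝ) := by
  have h1 : ((j / M : ℕ) : ℝ) ≤ (j : ℝ) / M := Nat.cast_div_le
  have hM' : (2 : ℝ) ≤ M := by exact_mod_cast hM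
  rw [Nat.cast_sub (Nat.div_le_self _ _)]
  have h2 : (1 + 2 / (M : ℝ)) * ((j : ℝ) - (j : ℝ) / M) ≤ (1 + 2 / (M : ℝ)) * ((j : ℝ) - ((j / M : ℕ) : ℝ)) := by
    gcongr
  refine le_trans ?_ h2
  have : (1 + 2 / (M : ℝ)) * ((j : ℝ) - (j : ℝ) / M) - j = j * (M - 2) / M ^ 2 := by
    field_simp
    ring
  have h3 : 0 ≤ (j : ℝ) * (M - 2) / M ^ 2 := by
    apply div_nonneg (mul_nonneg (Nat.cast_nonneg _) (by linarith)) (by positivity)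
  linarith

/-- Slowing down the index of a non-increasing sequence by a factor `1 - 1 / M` increases its partial
sums by a factor of at most `1 + 2 / M`. -/
theorem sum_comp_sub_div_le {f : ℕ → ℝ} {M : ℕ} (hM : 2 ≤ M) (hf0 : ∀ i, 0 ≤ f i)
    (hf : ∀ i j, 1 ≤ i → i ≤ j → f j ≤ f i) (k : ℕ) :
    ∑ j ∈ Icc 1 k, f (j - j / M) ≤ (1 + 2 / M) * ∑ j ∈ Icc 1 k, f j := by
  -- The induction keeps track of the unused weight on the last index reached. It drops by 1 when
  -- the slowed index stays put, grows by 2/M when it advances, and is never negative by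
  -- `le_mul_sub_div`.
  have key : ∀ k : ℕ, ∑ j ∈ Icc 1 k, f (j - j / M) ≤
      (1 + 2 / M) * ∑ j ∈ Icc 1 (k - k / M), f j
        - ((1 + 2 / M) * ((k - k / M : ℕ) : ℝ) - k) * f (k - k / M) := by
    intro k
    induction k with
    | zero => simp
    | succ k ih =>
      rw [Finset.sum_Icc_succ_top (by omega)]
      have hs := le_mul_sub_div hM k
      rcases Nat.eq_zero_or_pos k with rfl | hk
      · have : (0 + 1) / M = 0 := Nat.div_eq_of_lt (by omega)
        simp [this]
        linarith
      have hlk := sub_div_pos hM hk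
      have hle : k / M ≤ k := Nat.div_le_self _ _
      by_cases hd : M ∣ k + 1
      · have e : (k + 1) - (k + 1) / M = k - k / M := by
          rw [Nat.succ_div, if_pos hd]; omega
        rw [e]
        push_cast
        linarith
      · have e : (k + 1) - (k + 1) / M = (k - k / M) + 1 := by
          rw [Nat.succ_div, if_neg hd]; omega
        rw [e, Finset.sum_Icc_succ_top (by omega)]
        have h1 := hf _ _ hlk (Nat.le_succ (k - k / M))
        have h2 := mul_le_mul_of_nonneg_left h1 (sub_nonneg.2 hs)
        push_cast
        simp only [Nat.succ_eq_add_one] at h2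
        linarith
  refine (key k).trans ?_
  have h1 : 0 ≤ ((1 + 2 / M) * ((k - k / M : ℕ) : ℝ) - k) * f (k - k / M) :=
    mul_nonneg (sub_nonneg.2 (le_mul_sub_div hM k)) (hf0 _)
  have h2 : ∑ j ∈ Icc 1 (k - k / M), f j ≤ ∑ j ∈ Icc 1 k, f j :=
    Finset.sum_le_sum_of_subset_of_nonneg (Icc_subset_Icc_right (Nat.sub_le _ _))
      fun i _ _ => hf0 i
  have h3 := mul_le_mul_of_nonneg_left h2 (show (0 : ℝ) ≤ 1 + 2 / M by positivity)
  linarith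

theorem sum_comp_half (f : ℕ → ℝ) {i n : ℕ} (h : i ≤ n) :
    ∑ j ∈ Ioc (2 * i) (2 * n), f ((j + 1) / 2) = 2 * ∑ m ∈ Ioc i n, f m := by
  induction n, h using Nat.le_induction with
  | base => simp
  | succ n hn ih =>
    rw [Finset.sum_Ioc_succ_top hn, show 2 * (n + 1) = 2 * n + 1 + 1 by ring,
      Finset.sum_Ioc_succ_top (by omega), Finset.sum_Ioc_succ_top (by omega), ih]
    have e1 : (2 * n + 1 + 1) / 2 = n + 1 := by omega
    have e2 : (2 * n + 1 + 1 + 1) / 2 = n + 1 := by omega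
    rw [e1, e2]; ring

/-! ### Deterministic stability of tails, indices and moments under domination. -/

/-- The tail sum of a sequence. -/
def tailSum (n : ℕ) (b : ℕ → ℝ) (i : ℕ) : ℝ := ∑ j ∈ Ioc i n, b j

theorem tailSum_nonneg {n : ℕ} {b : ℕ → ℝ} (hb : ∀ i, 0 ≤ b i) (i : ℕ) : 0 ≤ tailSum n b i :=
  Finset.sum_nonneg fun j _ => hb j

theorem tailSum_anti {n : ℕ} {b : ℕ → ℝ} (hb : ∀ i, 0 ≤ b i) {i j : ℕ} (h : i ≤ j) :
    tailSum n b j ≤ tailSum n b i :=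
  Finset.sum_le_sum_of_subset_of_nonneg (Ioc_subset_Ioc_left h) fun _ _ _ => hb _

/-- `b` is dominated by `b'` up to a relative perturbation `1 / M` of indices and values, and an
additive error proportional to the tail sums. -/
def Dominated (n M : ℕ) (η : ℝ) (b b' : ℕ → ℝ) : Prop :=
  ∀ j, 1 ≤ j → j ≤ n →
    b j ≤ (1 + 1 / M) * b' (j - j / M) + η / j * (tailSum n b (2 * j) + tailSum n b' (2 * j))

/-- For j > 2i the shifted rank is still at least (j + 1)/2 > i, and each such half-rank occurs at
most twice. Summing the domination gives T ≤ 4T' + (T + T')/4 for the two tails, because the factors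
η/j sum to at most 1/4. -/
theorem Dominated.tail_le {n M : ℕ} {η H : ℝ} {b b' : ℕ → ℝ} (hM : 2 ≤ M) (hη : 0 ≤ η)
    (hH : ∑ j ∈ Icc 1 n, (1 : ℝ) / j ≤ H) (hηH : η * H ≤ 1 / 4)
    (h0 : ∀ i, 0 ≤ b i) (h0' : ∀ i, 0 ≤ b' i)
    (ha' : ∀ i j, 1 ≤ i → i ≤ j → b' j ≤ b' i) (h : Dominated n M η b b') (i : ℕ) :
    tailSum n b (2 * i) ≤ 6 * tailSum n b' i := by
  rcases le_or_gt n i with hi | hi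
  · have : tailSum n b (2 * i) = 0 := by
      unfold tailSum; rw [Finset.Ioc_eq_empty (by omega), sum_empty]
    have := tailSum_nonneg h0' (n := n) i
    linarith
  have hMr : (2 : ℝ) ≤ M := by exact_mod_cast hM
  have hM2 : 1 + 1 / (M : ℝ) ≤ 2 := by
    have : 1 / (M : ℝ) ≤ 1 := by rw [div_le_one (by linarith)]; linarith
    linarith
  have step : ∀ j ∈ Ioc (2 * i) n, b j ≤ 2 * b' ((j + 1) / 2)
      + η * (tailSum n b (2 * i) + tailSum n b' i) * (1 / j) := by
    intro j hj
    rw [mem_Ioc] at hj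
    have hle : j / M ≤ j / 2 := Nat.div_le_div_left hM (by norm_num)
    have h1 := ha' ((j + 1) / 2) (j - j / M) (by omega) (by omega)
    have h2 := tailSum_anti (n := n) h0 (i := 2 * i) (j := 2 * j) (by omega)
    have h3 := tailSum_anti (n := n) h0' (i := i) (j := 2 * j) (by omega)
    have h4 : η / j * (tailSum n b (2 * j) + tailSum n b' (2 * j)) ≤
        η * (tailSum n b (2 * i) + tailSum n b' i) * (1 / j) := by
      rw [mul_one_div, div_mul_eq_mul_div]
      gcongr
    have h5 : (1 + 1 / (M : ℝ)) * b' (j - j / M) ≤ 2 * b' ((j + 1) / 2) :=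
      mul_le_mul hM2 h1 (h0' _) (by norm_num)
    linarith [h j (by omega) hj.2]
  have hsum : tailSum n b (2 * i) ≤ 2 * (2 * tailSum n b' i)
      + η * (tailSum n b (2 * i) + tailSum n b' i) * H := by
    calc tailSum n b (2 * i) ≤ ∑ j ∈ Ioc (2 * i) n, (2 * b' ((j + 1) / 2)
          + η * (tailSum n b (2 * i) + tailSum n b' i) * (1 / j)) := Finset.sum_le_sum step
      _ = 2 * ∑ j ∈ Ioc (2 * i) n, b' ((j + 1) / 2)
          + η * (tailSum n b (2 * i) + tailSum n b' i) * ∑ j ∈ Ioc (2 * i) n, (1 : ℝ) / j := by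
        rw [Finset.sum_add_distrib, ← Finset.mul_sum, ← Finset.mul_sum]
      _ ≤ _ := by
        have hnn : 0 ≤ η * (tailSum n b (2 * i) + tailSum n b' i) :=
          mul_nonneg hη (add_nonneg (tailSum_nonneg h0 _) (tailSum_nonneg h0' _))
        have g1 : ∑ j ∈ Ioc (2 * i) n, b' ((j + 1) / 2) ≤ 2 * tailSum n b' i := by
          rw [tailSum, ← sum_comp_half b' hi.le]
          exact Finset.sum_le_sum_of_subset_of_nonneg (Ioc_subset_Ioc_right (by omega))
            fun _ _ _ => h0' _
        have g2 : ∑ j ∈ Ioc (2 * i) n, (1 : ℝ) / j ≤ H := by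
          refine le_trans (Finset.sum_le_sum_of_subset_of_nonneg ?_ fun _ _ _ => by positivity) hH
          intro j hj
          rw [mem_Ioc] at hj
          rw [mem_Icc]; omega
        gcongr
  have h1 := tailSum_nonneg h0 (n := n) (2 * i)
  have h2 := tailSum_nonneg h0' (n := n) i
  have h3 : η * (tailSum n b (2 * i) + tailSum n b' i) * H ≤ 1 / 4 * (tailSum n b (2 * i) + tailSum n b' i) := by
    have := mul_le_mul_of_nonneg_right hηH (add_nonneg h1 h2)
    linarith
  linarith

/-- A non-increasing nonnegative sequence `b` (of squares), with index `k` and the guarantee that the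
tail after `k` is not heavy. -/
structure Admissible (n : ℕ) (θ : ℝ) (b : ℕ → ℝ) (k : ℕ) : Prop where
  nonneg : ∀ i, 0 ≤ b i
  anti : ∀ i j, 1 ≤ i → i ≤ j → b j ≤ b i
  le : k ≤ n
  ge_index : 1 ≤ k → (k : ℝ) ^ 2 ≤ b k
  le_index : ∀ j, k < j → b j ≤ (k : ℝ) ^ 2
  tail_le : θ * tailSum n b k ≤ k * b k

/-- If the shifted rank of k' exceeds k, then b is at most k² there while b'_{k'} ≥ k'². The tail
condition turns the additive error at k' into at most b'_{k'}/M, so k'² and k² differ by a factor of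
at most (1 + 1/M)/(1 - 1/M). -/
theorem Dominated.index_le {n M : ℕ} {η H θ : ℝ} {b b' : ℕ → ℝ} {k k' : ℕ} (hM : 4 ≤ M) (hη : 0 ≤ η)
    (hH : ∑ j ∈ Icc 1 n, (1 : ℝ) / j ≤ H) (hηH : η * H ≤ 1 / 4)
    (hηθ : 7 * η * M ≤ θ)
    (hb : Admissible n θ b k) (hb' : Admissible n θ b' k')
    (h : Dominated n M η b b') (h' : Dominated n M η b' b) :
    (k' : ℝ) ≤ (1 + 4 / M) * k := by
  have hMr : (4 : ℝ) ≤ M := by exact_mod_cast hM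
  have hM0 : (0 : ℝ) < M := by linarith
  rcases le_or_gt k' k with hk | hk
  · have : (k' : ℝ) ≤ k := by exact_mod_cast hk
    have h2 : 0 ≤ 4 / (M : ℝ) * k := by positivity
    linarith
  rcases le_or_gt (k' - k' / M) k with hl | hl
  · have h1 := le_mul_sub_div (show 2 ≤ M by omega) k'
    have h2 : ((k' - k' / M : ℕ) : ℝ) ≤ k := by exact_mod_cast hl
    have h3 : (1 + 2 / (M : ℝ)) * ((k' - k' / M : ℕ) : ℝ) ≤ (1 + 4 / M) * k := by
      gcongr; norm_num
    linarith
  have hk1 : 1 ≤ k' := by omega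
  have hk1r : (1 : ℝ) ≤ k' := by exact_mod_cast hk1
  have h1 := h' k' hk1 hb'.le
  have h2 := h.tail_le (by omega) hη hH hηH hb.nonneg hb'.nonneg hb'.anti k'
  have h3 := tailSum_anti (n := n) hb'.nonneg (show k' ≤ 2 * k' by omega)
  have h4 := hb'.tail_le
  have h5 := hb'.ge_index hk1
  have h6 := hb.le_index _ hl
  -- The 7 is one tail of b' plus six from comparing the tail of b with it.
  have h7 : η / k' * (tailSum n b' (2 * k') + tailSum n b (2 * k')) ≤ 1 / M * b' k' := by
    have g1 : tailSum n b' (2 * k') + tailSum n b (2 * k') ≤ 7 * tailSum n b' k' := by linarith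
    have g2 : η / k' * (tailSum n b' (2 * k') + tailSum n b (2 * k')) ≤ η / k' * (7 * tailSum n b' k') := by
      gcongr
    refine g2.trans ?_
    rw [div_mul_eq_mul_div, div_le_iff₀ (by linarith), div_mul_eq_mul_div, div_mul_eq_mul_div,
      le_div_iff₀ hM0]
    have g3 := mul_le_mul_of_nonneg_right hηθ (tailSum_nonneg (n := n) hb'.nonneg k')
    linarith
  have h8 : (1 - 1 / (M : ℝ)) * (k' : ℝ) ^ 2 ≤ (1 + 1 / M) * (k : ℝ) ^ 2 := by
    have e1 : (0 : ℝ) ≤ 1 - 1 / (M : ℝ) := by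
      have : 1 / (M : ℝ) ≤ 1 := by rw [div_le_one hM0]; linarith
      linarith
    have e2 := mul_le_mul_of_nonneg_left h5 e1
    have e3 := mul_le_mul_of_nonneg_left h6 (show (0 : ℝ) ≤ 1 + 1 / M by positivity)
    linarith
  set z : ℝ := 1 / M with hz
  have hz0 : 0 < z := by positivity
  have hz4 : z ≤ 1 / 4 := by rw [hz]; gcongr
  have e4 : (4 : ℝ) / M = 4 * z := by rw [hz]; ring
  rw [e4]
  have h9 : (1 - z) * (k' : ℝ) ^ 2 ≤ (1 - z) * ((1 + 4 * z) * k) ^ 2 := by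
    refine h8.trans ?_
    have : 1 + z ≤ (1 - z) * (1 + 4 * z) ^ 2 := by nlinarith [mul_pos hz0 hz0, mul_pos (mul_pos hz0 hz0) hz0]
    have := mul_le_mul_of_nonneg_right this (sq_nonneg (k : ℝ))
    nlinarith
  have h10 : (k' : ℝ) ^ 2 ≤ ((1 + 4 * z) * k) ^ 2 := le_of_mul_le_mul_left h9 (by linarith)
  exact le_of_sq_le_sq h10 (by positivity)

/-- Up to rank k, write b_l = b_l^(1-π) · b_l^π and bound the first factor by b_j^(1-π). Beyond k,
the tail condition reduces the tail to k·b_k/θ, to which the same splitting applies. -/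
theorem Admissible.tail_le_moment {n k j : ℕ} {θ π : ℝ} {b : ℕ → ℝ} (hθ : 0 < θ) (hθ1 : θ ≤ 1)
    (hπ0 : 0 ≤ π) (hπ1 : π ≤ 1) (hb : Admissible n θ b k) (hj : 1 ≤ j) (hjk : j ≤ k) :
    tailSum n b j ≤ b j ^ (1 - π) * (2 / θ * ∑ i ∈ Icc 1 k, b i ^ π) := by
  have hk1 : (1 : ℝ) ≤ k := by exact_mod_cast hj.trans hjk
  have hpos : ∀ l, 1 ≤ l → l ≤ k → 0 < b l := fun l h1 h2 =>
    lt_of_lt_of_le (by positivity) ((hb.ge_index (by omega)).trans (hb.anti l k h1 h2))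
  have hsplit : ∀ l, j ≤ l → l ≤ k → b l ≤ b j ^ (1 - π) * b l ^ π := by
    intro l h1 h2
    have hl := hpos l (by omega) h2
    calc b l = b l ^ (1 - π) * b l ^ π := by
          rw [← Real.rpow_add hl]; simp
      _ ≤ _ := mul_le_mul_of_nonneg_right
          (Real.rpow_le_rpow hl.le (hb.anti _ _ hj h1) (by linarith)) (Real.rpow_nonneg hl.le _)
  have hT : ∀ A : Finset ℕ, A ⊆ Icc 1 k → ∑ i ∈ A, b i ^ π ≤ ∑ i ∈ Icc 1 k, b i ^ π := fun A hA =>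
    Finset.sum_le_sum_of_subset_of_nonneg hA fun i _ _ => Real.rpow_nonneg (hb.nonneg i) _
  have e : tailSum n b j = ∑ l ∈ Ioc j k, b l + tailSum n b k := by
    rw [tailSum, tailSum, ← Finset.sum_union]
    · rw [Ioc_union_Ioc_eq_Ioc hjk hb.le]
    · rw [Finset.disjoint_left]; intro a; simp only [mem_Ioc]; omega
  have h1 : ∑ l ∈ Ioc j k, b l ≤ b j ^ (1 - π) * ∑ i ∈ Icc 1 k, b i ^ π := by
    calc ∑ l ∈ Ioc j k, b l ≤ ∑ l ∈ Ioc j k, b j ^ (1 - π) * b l ^ π :=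
          Finset.sum_le_sum fun l hl => by rw [mem_Ioc] at hl; exact hsplit l (by omega) hl.2
      _ = b j ^ (1 - π) * ∑ l ∈ Ioc j k, b l ^ π := by rw [Finset.mul_sum]
      _ ≤ _ := by
        refine mul_le_mul_of_nonneg_left (hT _ fun a => ?_) (Real.rpow_nonneg (hb.nonneg j) _)
        simp only [mem_Ioc, mem_Icc]; omega
  have h2 : (k : ℝ) * b k ^ π ≤ ∑ i ∈ Icc 1 k, b i ^ π := by
    have : ∑ i ∈ Icc 1 k, b k ^ π ≤ ∑ i ∈ Icc 1 k, b i ^ π :=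
      Finset.sum_le_sum fun i hi => by
        rw [mem_Icc] at hi
        exact Real.rpow_le_rpow (hb.nonneg k) (hb.anti _ _ hi.1 hi.2) hπ0
    simpa using this
  have h3 : tailSum n b k ≤ 1 / θ * (b j ^ (1 - π) * ∑ i ∈ Icc 1 k, b i ^ π) := by
    rw [div_mul_eq_mul_div, le_div_iff₀ hθ, one_mul, mul_comm]
    refine hb.tail_le.trans ?_
    calc (k : ℝ) * b k ≤ k * (b j ^ (1 - π) * b k ^ π) := by
          gcongr; exact hsplit k hjk le_rfl
      _ = b j ^ (1 - π) * (k * b k ^ π) := by ring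
      _ ≤ _ := by
        gcongr
        exact Real.rpow_nonneg (hb.nonneg j) _
  have h4 : (0 : ℝ) ≤ b j ^ (1 - π) * ∑ i ∈ Icc 1 k, b i ^ π :=
    mul_nonneg (Real.rpow_nonneg (hb.nonneg j) _)
      (Finset.sum_nonneg fun i _ => Real.rpow_nonneg (hb.nonneg i) _)
  have h5 : (1 : ℝ) ≤ 1 / θ := by rw [le_div_iff₀ hθ]; linarith
  rw [e]
  calc _ ≤ b j ^ (1 - π) * ∑ i ∈ Icc 1 k, b i ^ π + 1 / θ * (b j ^ (1 - π) * ∑ i ∈ Icc 1 k, b i ^ π) :=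
        add_le_add h1 h3
    _ ≤ 1 / θ * (b j ^ (1 - π) * ∑ i ∈ Icc 1 k, b i ^ π)
        + 1 / θ * (b j ^ (1 - π) * ∑ i ∈ Icc 1 k, b i ^ π) := by
      have := mul_le_mul_of_nonneg_right h5 h4
      linarith
    _ = _ := by ring

theorem one_add_mul_rpow_le {s x π : ℝ} (hs : 0 ≤ s) (hx : 0 ≤ x) (hπ1 : π ≤ 1) :
    ((1 + s) * x) ^ π ≤ (1 + s) * x ^ π := by
  rw [Real.mul_rpow (by linarith) hx]
  gcongr
  calc (1 + s) ^ π ≤ (1 + s) ^ (1 : ℝ) := Real.rpow_le_rpow_of_exponent_le (by linarith) hπ1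
    _ = 1 + s := Real.rpow_one _

theorem Dominated.moment_le {n M : ℕ} {η H θ π : ℝ} {b b' : ℕ → ℝ} {k k' : ℕ} (hM : 4 ≤ M)
    (hη : 0 ≤ η) (hH : ∑ j ∈ Icc 1 n, (1 : ℝ) / j ≤ H) (hηH : η * H ≤ 1 / 4) (hθ : 0 < θ)
    (hθ1 : θ ≤ 1) (hηθ : 7 * η * M ≤ θ) (hηHθ : 42 * η * H * M ^ 2 ≤ θ)
    (hπ0 : 0 ≤ π) (hπ1 : π ≤ 1)
    (hb : Admissible n θ b k) (hb' : Admissible n θ b' k')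
    (h : Dominated n M η b b') (h' : Dominated n M η b' b) :
    ∑ i ∈ Icc 1 k', b' i ^ π ≤ (1 + 16 / M) * ∑ i ∈ Icc 1 k, b i ^ π := by
  have hMr : (4 : ℝ) ≤ M := by exact_mod_cast hM
  have hM0 : (0 : ℝ) < M := by linarith
  set T := ∑ i ∈ Icc 1 k, b i ^ π with hTdef
  have hT0 : 0 ≤ T := Finset.sum_nonneg fun i _ => Real.rpow_nonneg (hb.nonneg i) _
  have hk' := h.index_le hM hη hH hηH hηθ hb hb' h'
  set z : ℝ := 1 / M with hz
  have hz0 : 0 < z := by positivity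
  have hz4 : z ≤ 1 / 4 := by rw [hz]; gcongr
  have term : ∀ j ∈ Icc 1 k, j ≤ n → b' j ^ π ≤
      (1 + 2 * z) * b (j - j / M) ^ π + 42 * η * M / θ * T * (1 / j) := by
    intro j hj hjn
    rw [mem_Icc] at hj
    have hj0 : (0 : ℝ) < j := by exact_mod_cast hj.1
    have hnn : 0 ≤ 42 * η * M / θ * T * (1 / j) := by positivity
    have hlj := hb.anti (j - j / M) j (sub_div_pos (by omega) hj.1) (Nat.sub_le _ _)
    have h1 := h' j hj.1 hjn
    have h2 := h'.tail_le (by omega) hη hH hηH hb'.nonneg hb.nonneg hb.anti j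
    have h3 := tailSum_anti (n := n) hb.nonneg (show j ≤ 2 * j by omega)
    set E := η / j * (7 * tailSum n b j) with hE
    have h4 : b' j ≤ (1 + z) * b (j - j / M) + E := by
      refine h1.trans ?_
      rw [hE]
      gcongr
      linarith
    rcases le_or_gt E (z * b (j - j / M)) with hc | hc
    · have h5 : b' j ≤ (1 + 2 * z) * b (j - j / M) := by linarith
      have h6 := Real.rpow_le_rpow (hb'.nonneg j) h5 hπ0
      have h7 := one_add_mul_rpow_le (s := 2 * z) (by linarith) (hb.nonneg (j - j / M)) hπ1
      linarith
    -- When the error dominates, b'_j ≤ X with X a multiple of the tail after j. The tail is at most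
    -- X^(1-π) times a multiple of the moment, so dividing by X^(1-π) bounds X^π itself, uniformly
    -- in π.
    · have hzb : 0 ≤ z * b (j - j / M) := mul_nonneg hz0.le (hb.nonneg _)
      set X := 3 * (M * E) with hX
      have hE0 : 0 < E := by linarith
      have hX0 : 0 < X := by positivity
      have hbX : b (j - j / M) ≤ M * E := by
        rw [hz, div_mul_eq_mul_div, one_mul, div_lt_iff₀ hM0] at hc
        linarith
      have hME : E ≤ M * E := by nlinarith
      have h5 : b' j ≤ X := by
        have : (1 + z) * b (j - j / M) ≤ 2 * (M * E) :=
          mul_le_mul (by linarith) hbX (hb.nonneg _) (by norm_num)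
        linarith
      have h6 : b j ^ (1 - π) ≤ X ^ (1 - π) :=
        Real.rpow_le_rpow (hb.nonneg j) (by rw [hX]; nlinarith) (by linarith)
      have h7 := hb.tail_le_moment hθ hθ1 hπ0 hπ1 hj.1 hj.2
      have h8 : X ≤ X ^ (1 - π) * (42 * η * M / θ * T * (1 / j)) := by
        calc X = 21 * M * (η / j) * tailSum n b j := by rw [hX, hE]; ring
          _ ≤ 21 * M * (η / j) * (b j ^ (1 - π) * (2 / θ * T)) := by gcongr
          _ ≤ 21 * M * (η / j) * (X ^ (1 - π) * (2 / θ * T)) := by gcongr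
          _ = _ := by ring
      have h9 : X = X ^ (1 - π) * X ^ π := by rw [← Real.rpow_add hX0]; simp
      have h10 : X ^ π ≤ 42 * η * M / θ * T * (1 / j) := by
        refine le_of_mul_le_mul_left ?_ (Real.rpow_pos_of_pos hX0 (1 - π))
        rwa [← h9]
      have h11 := Real.rpow_le_rpow (hb'.nonneg j) h5 hπ0
      have h12 : 0 ≤ (1 + 2 * z) * b (j - j / M) ^ π :=
        mul_nonneg (by linarith) (Real.rpow_nonneg (hb.nonneg _) _)
      linarith
  have main : ∑ i ∈ Icc 1 k, b' i ^ π ≤ ((1 + 2 * z) * (1 + 2 * z) + z) * T := by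
    have hle := hb.le
    calc ∑ i ∈ Icc 1 k, b' i ^ π ≤ ∑ j ∈ Icc 1 k, ((1 + 2 * z) * b (j - j / M) ^ π
          + 42 * η * M / θ * T * (1 / j)) := Finset.sum_le_sum fun j hj =>
            term j hj (by rw [mem_Icc] at hj; omega)
      _ = (1 + 2 * z) * ∑ j ∈ Icc 1 k, b (j - j / M) ^ π
          + 42 * η * M / θ * T * ∑ j ∈ Icc 1 k, (1 : ℝ) / j := by
        rw [Finset.sum_add_distrib, ← Finset.mul_sum, ← Finset.mul_sum]
      _ ≤ (1 + 2 * z) * ((1 + 2 / M) * T) + 42 * η * M / θ * T * H := by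
        have g1 := sum_comp_sub_div_le (f := fun i => b i ^ π) (M := M) (by omega)
          (fun i => Real.rpow_nonneg (hb.nonneg i) _)
          (fun i j hi hij => Real.rpow_le_rpow (hb.nonneg j) (hb.anti i j hi hij) hπ0) k
        have g2 : ∑ j ∈ Icc 1 k, (1 : ℝ) / j ≤ H :=
          le_trans (Finset.sum_le_sum_of_subset_of_nonneg (Icc_subset_Icc_right hle)
            fun _ _ _ => by positivity) hH
        gcongr
      _ ≤ _ := by
        have e1 : (2 : ℝ) / M = 2 * z := by rw [hz]; ring
        have e2 : 42 * η * M / θ * T * H ≤ z * T := by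
          have : 42 * η * M / θ * H ≤ z := by
            rw [hz, div_mul_eq_mul_div, div_le_div_iff₀ hθ hM0]
            linarith
          have := mul_le_mul_of_nonneg_right this hT0
          linarith
        rw [e1]
        linarith
  have e16 : (16 : ℝ) / M = 16 * z := by rw [hz]; ring
  rw [e16]
  rcases le_or_gt k' k with hkk | hkk
  · have h1 : ∑ i ∈ Icc 1 k', b' i ^ π ≤ ∑ i ∈ Icc 1 k, b' i ^ π :=
      Finset.sum_le_sum_of_subset_of_nonneg (Icc_subset_Icc_right hkk)
        fun i _ _ => Real.rpow_nonneg (hb'.nonneg i) _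
    have h2 : (1 + 2 * z) * (1 + 2 * z) + z ≤ 1 + 16 * z := by nlinarith
    have := mul_le_mul_of_nonneg_right h2 hT0
    linarith
  -- There are at most 4k/M extra ranks after k, and each contributes no more than the average of
  -- the first k terms.
  · have hk0 : 1 ≤ k := by
      by_contra hcon
      have : k = 0 := by omega
      subst this
      simp at hk'
      omega
    set T' := ∑ i ∈ Icc 1 k, b' i ^ π with hT'
    have hT'0 : 0 ≤ T' := Finset.sum_nonneg fun i _ => Real.rpow_nonneg (hb'.nonneg i) _
    have hk0r : (0 : ℝ) < k := by exact_mod_cast hk0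
    have h1 : ∑ i ∈ Icc 1 k', b' i ^ π = T' + ∑ i ∈ Ioc k k', b' i ^ π := by
      rw [hT', ← Finset.sum_union]
      · congr 1; ext a; simp only [mem_union, mem_Icc, mem_Ioc]; omega
      · rw [Finset.disjoint_left]; intro a; simp only [mem_Icc, mem_Ioc]; omega
    have h2 : (k : ℝ) * b' k ^ π ≤ T' := by
      have : ∑ i ∈ Icc 1 k, b' k ^ π ≤ ∑ i ∈ Icc 1 k, b' i ^ π :=
        Finset.sum_le_sum fun i hi => by
          rw [mem_Icc] at hi
          exact Real.rpow_le_rpow (hb'.nonneg k) (hb'.anti _ _ hi.1 hi.2) hπ0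
      simpa using this
    have h3 : ∑ i ∈ Ioc k k', b' i ^ π ≤ ((k' : ℝ) - k) * b' k ^ π := by
      have : ∑ i ∈ Ioc k k', b' i ^ π ≤ ∑ i ∈ Ioc k k', b' k ^ π :=
        Finset.sum_le_sum fun i hi => by
          rw [mem_Ioc] at hi
          exact Real.rpow_le_rpow (hb'.nonneg i) (hb'.anti _ _ hk0 hi.1.le) hπ0
      rw [Finset.sum_const, Nat.card_Ioc, nsmul_eq_mul, Nat.cast_sub hkk.le] at this
      exact this
    have h4 : ((k' : ℝ) - k) * b' k ^ π ≤ 4 * z * T' := by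
      have e4 : (4 : ℝ) / M = 4 * z := by rw [hz]; ring
      rw [e4] at hk'
      have : (k' : ℝ) - k ≤ 4 * z * k := by linarith
      have := mul_le_mul_of_nonneg_right this (Real.rpow_nonneg (hb'.nonneg k) π)
      have := mul_le_mul_of_nonneg_left h2 (show 0 ≤ 4 * z by linarith)
      linarith
    have h5 : (1 + 4 * z) * ((1 + 2 * z) * (1 + 2 * z) + z) ≤ 1 + 16 * z := by
      nlinarith [mul_pos hz0 hz0]
    calc ∑ i ∈ Icc 1 k', b' i ^ π ≤ (1 + 4 * z) * T' := by linarith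
      _ ≤ (1 + 4 * z) * (((1 + 2 * z) * (1 + 2 * z) + z) * T) := by gcongr
      _ ≤ (1 + 16 * z) * T := by
        have := mul_le_mul_of_nonneg_right h5 hT0
        linarith

/-! ### Second and fourth moments of random signed sums. -/

section Signs

/-- A family of random signs with the cancellation that `4`-wise independence provides. -/
structure IsSignFamily {Ω ι : Type*} [Fintype Ω] (σ : Ω → ι → ℤ) : Prop where
  mul_self : ∀ s i, σ s i * σ s i = 1
  orth : ∀ i j k l, i ≠ j → i ≠ k → i ≠ l → ∑ s, σ s i * σ s j * σ s k * σ s l = 0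

variable {Ω ι : Type*} [Fintype Ω] {σ : Ω → ι → ℤ}

theorem IsSignFamily.comp {κ : Type*} (h : IsSignFamily σ) {g : κ → ι} (hg : Function.Injective g) :
    IsSignFamily fun s i => σ s (g i) :=
  ⟨fun s _ => h.mul_self s _, fun _ _ _ _ h1 h2 h3 =>
    h.orth _ _ _ _ (hg.ne h1) (hg.ne h2) (hg.ne h3)⟩

theorem IsSignFamily.sum_pair [DecidableEq ι] (h : IsSignFamily σ) (i j : ι) :
    ∑ s, (σ s i : ℝ) * σ s j = if i = j then (Fintype.card Ω : ℝ) else 0 := by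
  have hZ : ∑ s, σ s i * σ s j = if i = j then (Fintype.card Ω : ℤ) else 0 := by
    split_ifs with hij
    · subst hij; simp [h.mul_self]
    · rw [← h.orth i j j j hij hij hij]
      refine Finset.sum_congr rfl fun s _ => ?_
      rw [mul_assoc (σ s i * σ s j), h.mul_self, mul_one]
  exact_mod_cast hZ

/-- If the two off-diagonal pairs are not equal up to order, some index occurs only once among the
four and cancellation applies. -/
theorem IsSignFamily.sum_quad [DecidableEq ι] (h : IsSignFamily σ) {p r : ι × ι} (hp : p.1 ≠ p.2) (hr : r.1 ≠ r.2) :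
    ∑ s, (σ s p.1 : ℝ) * σ s p.2 * σ s r.1 * σ s r.2 =
      Fintype.card Ω * ((if p = r then 1 else 0) + (if p.swap = r then 1 else 0)) := by
  obtain ⟨i, j⟩ := p
  obtain ⟨k, l⟩ := r
  simp only [ne_eq, Prod.mk.injEq, Prod.swap_prod_mk] at *
  have sq : ∀ (s : Ω) (i : ι), (σ s i : ℝ) * σ s i = 1 := fun s i => by exact_mod_cast h.mul_self s i
  have orth : ∀ i j k l, i ≠ j → i ≠ k → i ≠ l →
      ∑ s, (σ s i : ℝ) * σ s j * σ s k * σ s l = 0 := fun i j k l h1 h2 h3 => by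
    exact_mod_cast h.orth i j k l h1 h2 h3
  by_cases hik : i = k
  · subst hik
    by_cases hjl : j = l
    · subst hjl
      have : ¬ j = i := fun h => hp h.symm
      simp only [and_self, if_true, this, false_and, if_false, add_zero, mul_one]
      rw [Finset.sum_congr rfl fun s _ => show (σ s i : ℝ) * σ s j * σ s i * σ s j = 1 by
        rw [show (σ s i : ℝ) * σ s j * σ s i * σ s j = (σ s i * σ s i) * (σ s j * σ s j) by ring,
          sq, sq, one_mul]]
      simp
    · have : ¬ j = i := fun h => hp h.symm
      simp only [hjl, this, and_false, false_and, if_false, add_zero, mul_zero]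
      rw [← orth l i j i (Ne.symm hr) (Ne.symm hjl) (Ne.symm hr)]
      exact Finset.sum_congr rfl fun s _ => by ring
  · by_cases hil : i = l
    · subst hil
      by_cases hjk : j = k
      · subst hjk
        simp only [hp, false_and, if_false, and_self, if_true, zero_add, mul_one]
        rw [Finset.sum_congr rfl fun s _ => show (σ s i : ℝ) * σ s j * σ s j * σ s i = 1 by
          rw [show (σ s i : ℝ) * σ s j * σ s j * σ s i = (σ s i * σ s i) * (σ s j * σ s j) by ring,
            sq, sq, one_mul]]
        simp
      · simp only [hik, hjk, false_and, if_false, add_zero, mul_zero]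
        rw [← orth k i j i (Ne.symm hik) (Ne.symm hjk) (Ne.symm hik)]
        exact Finset.sum_congr rfl fun s _ => by ring
    · simp only [hik, hil, and_false, false_and, if_false, add_zero, mul_zero]
      exact orth i j k l hp hik hil

variable [Fintype ι] [DecidableEq ι]

theorem IsSignFamily.second_moment (h : IsSignFamily σ) (y : ι → ℝ) :
    ∑ s, (∑ i, σ s i * y i) ^ 2 = Fintype.card Ω * ∑ i, y i ^ 2 := by
  calc ∑ s, (∑ i, σ s i * y i) ^ 2
      = ∑ s, ∑ i, ∑ j, y i * y j * ((σ s i : ℝ) * σ s j) := by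
        refine Finset.sum_congr rfl fun s _ => ?_
        rw [pow_two, Finset.sum_mul_sum]
        exact Finset.sum_congr rfl fun i _ => Finset.sum_congr rfl fun j _ => by ring
    _ = ∑ i, ∑ j, y i * y j * ∑ s, (σ s i : ℝ) * σ s j := by
        rw [Finset.sum_comm]
        refine Finset.sum_congr rfl fun i _ => ?_
        rw [Finset.sum_comm]
        exact Finset.sum_congr rfl fun j _ => by rw [Finset.mul_sum]
    _ = _ := by
        rw [Finset.mul_sum]
        refine Finset.sum_congr rfl fun i _ => ?_
        simp only [h.sum_pair, mul_ite, mul_zero, Finset.sum_ite_eq, Finset.mem_univ, if_true]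
        ring

theorem sum_offDiag_mul (g : ι → ℝ) :
    ∑ p ∈ (univ : Finset ι).offDiag, g p.1 * g p.2 = (∑ i, g i) ^ 2 - ∑ i, g i ^ 2 := by
  have h := Finset.sum_union (Finset.disjoint_diag_offDiag (univ : Finset ι))
    (f := fun p => g p.1 * g p.2)
  rw [Finset.diag_union_offDiag, Finset.sum_product, Finset.sum_diag] at h
  rw [pow_two, Finset.sum_mul_sum]
  simp only [sq]
  linarith

/-- The squared sum minus its diagonal is a sum over ordered off-diagonal pairs; in its square each
pair survives only against itself and its reversal, hence the factor 2. -/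
theorem IsSignFamily.fourth_moment (h : IsSignFamily σ) (y : ι → ℝ) :
    ∑ s, ((∑ i, σ s i * y i) ^ 2 - ∑ i, y i ^ 2) ^ 2 =
      2 * Fintype.card Ω * ((∑ i, y i ^ 2) ^ 2 - ∑ i, y i ^ 4) := by
  have e : ∀ s, (∑ i, σ s i * y i) ^ 2 - ∑ i, y i ^ 2 =
      ∑ p ∈ (univ : Finset ι).offDiag, ((σ s p.1 : ℝ) * y p.1) * (σ s p.2 * y p.2) := by
    intro s
    rw [sum_offDiag_mul fun i => (σ s i : ℝ) * y i]
    congr 1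
    refine Finset.sum_congr rfl fun i _ => ?_
    have : (σ s i : ℝ) * σ s i = 1 := by exact_mod_cast h.mul_self s i
    rw [mul_pow, pow_two (σ s i : ℝ), this, one_mul]
  calc ∑ s, ((∑ i, σ s i * y i) ^ 2 - ∑ i, y i ^ 2) ^ 2
      = ∑ s, ∑ p ∈ (univ : Finset ι).offDiag, ∑ r ∈ (univ : Finset ι).offDiag,
          y p.1 * y p.2 * (y r.1 * y r.2) * ((σ s p.1 : ℝ) * σ s p.2 * σ s r.1 * σ s r.2) := by
        refine Finset.sum_congr rfl fun s _ => ?_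
        rw [e, pow_two, Finset.sum_mul_sum]
        exact Finset.sum_congr rfl fun i _ => Finset.sum_congr rfl fun j _ => by ring
    _ = ∑ p ∈ (univ : Finset ι).offDiag, ∑ r ∈ (univ : Finset ι).offDiag,
          y p.1 * y p.2 * (y r.1 * y r.2) *
            ∑ s, ((σ s p.1 : ℝ) * σ s p.2 * σ s r.1 * σ s r.2) := by
        rw [Finset.sum_comm]
        refine Finset.sum_congr rfl fun i _ => ?_
        rw [Finset.sum_comm]
        exact Finset.sum_congr rfl fun j _ => by rw [Finset.mul_sum]
    _ = ∑ p ∈ (univ : Finset ι).offDiag, 2 * Fintype.card Ω * (y p.1 ^ 2 * y p.2 ^ 2) := by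
        refine Finset.sum_congr rfl fun p hp => ?_
        have hp' : p.swap ∈ (univ : Finset ι).offDiag := by
          simp only [mem_offDiag, mem_univ, true_and, Prod.fst_swap, Prod.snd_swap] at hp ⊢
          exact Ne.symm hp
        have : ∀ r ∈ (univ : Finset ι).offDiag, y p.1 * y p.2 * (y r.1 * y r.2) *
            ∑ s, ((σ s p.1 : ℝ) * σ s p.2 * σ s r.1 * σ s r.2) =
            (if p = r then Fintype.card Ω * (y p.1 * y p.2 * (y r.1 * y r.2)) else 0) +
            (if p.swap = r then Fintype.card Ω * (y p.1 * y p.2 * (y r.1 * y r.2)) else 0) := by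
          intro r hr
          rw [h.sum_quad (mem_offDiag.1 hp).2.2 (mem_offDiag.1 hr).2.2]
          split_ifs <;> ring
        rw [Finset.sum_congr rfl this, Finset.sum_add_distrib, Finset.sum_ite_eq,
          Finset.sum_ite_eq, if_pos hp, if_pos hp']
        simp only [Prod.fst_swap, Prod.snd_swap]
        ring
    _ = _ := by
        rw [← Finset.mul_sum, sum_offDiag_mul fun i => y i ^ 2]
        congr 2
        exact Finset.sum_congr rfl fun i _ => by ring

end Signs

/-! ### Signs from cubic polynomials and hashing from affine maps over a field with 2^w elements. -/

section Field

variable {F : Type*} [Field F]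

/-- The values of the cubic polynomial with coefficients `s`. -/
def cubic (s : Fin 4 → F) (x : F) : F := ∑ k, s k * x ^ (k : ℕ)

theorem cubic_add (s t : Fin 4 → F) (x : F) : cubic (s + t) x = cubic s x + cubic t x := by
  simp [cubic, add_mul, Finset.sum_add_distrib]

theorem exists_cubic (x : F) (S : Finset F) (hS : S.card ≤ 3) (hx : x ∉ S) :
    ∃ s : Fin 4 → F, cubic s x = 1 ∧ ∀ y ∈ S, cubic s y = 0 := by
  classical
  set P : Polynomial F := ∏ y ∈ S, (Polynomial.X - Polynomial.C y) with hP
  have hdeg : P.natDegree < 4 := by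
    rw [hP, Polynomial.natDegree_prod_of_monic _ _ fun y _ => Polynomial.monic_X_sub_C y]
    simp
    omega
  have hev : ∀ y, P.eval y = ∑ k : Fin 4, P.coeff k * y ^ (k : ℕ) := fun y => by
    rw [Polynomial.eval_eq_sum_range' hdeg, Finset.sum_range]
  have hx0 : P.eval x ≠ 0 := by
    rw [hP, Polynomial.eval_prod, Finset.prod_ne_zero_iff]
    intro y hy
    simp only [Polynomial.eval_sub, Polynomial.eval_X, Polynomial.eval_C]
    exact sub_ne_zero.2 fun h => hx (h ▸ hy)
  have hc : ∀ y, cubic (fun k => (P.eval x)⁻¹ * P.coeff k) y = (P.eval x)⁻¹ * P.eval y := by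
    intro y
    rw [hev y, cubic, Finset.mul_sum]
    exact Finset.sum_congr rfl fun k _ => by ring
  refine ⟨fun k => (P.eval x)⁻¹ * P.coeff k, by rw [hc, inv_mul_cancel₀ hx0], fun y hy => ?_⟩
  have hy0 : P.eval y = 0 := by
    rw [hP, Polynomial.eval_prod, Finset.prod_eq_zero hy (by simp)]
  rw [hc, hy0, mul_zero]

/-- Adding a cubic that is 1 at i and 0 at the other points permutes the seeds and flips exactly one
sign, so the sum equals its negative. -/
theorem cubic_signFamily [Fintype F] {χ : F → ℤ} (h1 : ∀ y, χ y * χ y = 1)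
    (h2 : ∀ y, χ (y + 1) = -χ y) : IsSignFamily fun (s : Fin 4 → F) (x : F) => χ (cubic s x) := by
  classical
  refine ⟨fun s i => h1 _, fun i j k l hij hik hil => ?_⟩
  obtain ⟨t, ht1, ht0⟩ := exists_cubic i {j, k, l} Finset.card_le_three (by simp [hij, hik, hil])
  have hsum := Equiv.sum_comp (Equiv.addRight t) fun s : Fin 4 → F =>
    χ (cubic s i) * χ (cubic s j) * χ (cubic s k) * χ (cubic s l)
  simp only [Equiv.coe_addRight, cubic_add, ht1, ht0 j (by simp), ht0 k (by simp), ht0 l (by simp),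
    add_zero, h2, neg_mul, Finset.sum_neg_distrib] at hsum
  linarith

/-- The sign is the parity of an 𝔽₂-linear functional that takes the value 1 at 1. -/
theorem exists_sign_flip [Algebra (ZMod 2) F] :
    ∃ χ : F → ℤ, (∀ y, χ y * χ y = 1) ∧ ∀ y, χ (y + 1) = -χ y := by
  obtain ⟨φ, hφ⟩ := Module.Projective.exists_dual_eq_one (ZMod 2) (one_ne_zero (α := F))
  refine ⟨fun y => if φ y = 0 then 1 else -1, fun y => by dsimp only; split_ifs <;> rfl, fun y => ?_⟩
  have : ∀ a : ZMod 2, (if a + 1 = 0 then (1 : ℤ) else -1) = -(if a = 0 then 1 else -1) := by decide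
  simp only [map_add, hφ, this]

/-- A family of hash functions under which any two keys are independent and uniform. -/
structure IsHashFamily {Ω ι Y : Type*} [Fintype Ω] [Fintype Y] (key : Ω → ι → Y) : Prop where
  card : (Fintype.card Ω : ℝ) = (Fintype.card Y : ℝ) ^ 2
  sum_single : ∀ i (f : Y → ℝ), ∑ s, f (key s i) = Fintype.card Y * ∑ y, f y
  sum_pair : ∀ i j, i ≠ j → ∀ f : Y → Y → ℝ, ∑ s, f (key s i) (key s j) = ∑ y, ∑ y', f y y'

theorem IsHashFamily.comp {Ω ι κ Y : Type*} [Fintype Ω] [Fintype Y] {key : Ω → ι → Y}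
    (h : IsHashFamily key) {g : κ → ι} (hg : Function.Injective g) :
    IsHashFamily fun s i => key s (g i) :=
  ⟨h.card, fun _ f => h.sum_single _ f, fun _ _ hij f => h.sum_pair _ _ (hg.ne hij) f⟩

/-- For x ≠ y, the map from (a, b) to the pair (ax + b, ay + b) is injective, hence a bijection of F
× F. -/
theorem affine_hashFamily [Fintype F] {Y : Type*} [Fintype Y] (ψ : F ≃ Y) :
    IsHashFamily fun (s : F × F) (x : F) => ψ (s.1 * x + s.2) := by
  refine ⟨?_, fun x f => ?_, fun x y hxy f => ?_⟩
  · rw [Fintype.card_prod, Fintype.card_congr ψ]; push_cast; ring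
  · have h1 : ∀ a : F, ∑ b, f (ψ (a * x + b)) = ∑ y, f y := fun a => by
      rw [← Equiv.sum_comp ψ f]
      exact Equiv.sum_comp (Equiv.addLeft (a * x)) fun b => f (ψ b)
    rw [Fintype.sum_prod_type]
    simp only [h1, Finset.sum_const, Finset.card_univ, nsmul_eq_mul, Fintype.card_congr ψ]
  · have hinj : Function.Injective fun s : F × F => (s.1 * x + s.2, s.1 * y + s.2) := by
      rintro ⟨a, b⟩ ⟨a', b'⟩ h
      simp only [Prod.mk.injEq] at h ⊢
      have h3 : (a - a') * (x - y) = 0 := by linear_combination h.1 - h.2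
      have ha : a = a' := sub_eq_zero.1 ((mul_eq_zero.1 h3).resolve_right (sub_ne_zero.2 hxy))
      refine ⟨ha, ?_⟩
      have := h.1
      rw [ha] at this
      exact add_left_cancel this
    have hbij := Finite.injective_iff_bijective.1 hinj
    rw [hbij.sum_comp fun p : F × F => f (ψ p.1) (ψ p.2), Fintype.sum_prod_type,
      ← Equiv.sum_comp ψ]
    exact Finset.sum_congr rfl fun a _ => Equiv.sum_comp ψ fun y' => f (ψ a) y'

end Field

theorem exists_families (w₁ w₂ n : ℕ) (hn : n ≤ 2 ^ (w₁ + w₂)) (hw : w₁ + w₂ ≠ 0) :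
    ∃ (key : (Fin (2 * (w₁ + w₂)) → Bool) → Fin n → Fin (2 ^ w₁) × Fin (2 ^ w₂))
      (σ : (Fin (4 * (w₁ + w₂)) → Bool) → Fin n → ℤ), IsHashFamily key ∧ IsSignFamily σ := by
  classical
  let F := GaloisField 2 (w₁ + w₂)
  let _ : Fintype F := Fintype.ofFinite F
  have hF : Fintype.card F = 2 ^ (w₁ + w₂) := by
    rw [← Nat.card_eq_fintype_card]; exact GaloisField.card 2 _ hw
  obtain ⟨χ, h1, h2⟩ := exists_sign_flip (F := F)
  obtain ⟨ψ⟩ : Nonempty (F ≃ Fin (2 ^ w₁) × Fin (2 ^ w₂)) := by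
    rw [← Fintype.card_eq]; simp [hF, pow_add]
  obtain ⟨e₁⟩ : Nonempty ((Fin (2 * (w₁ + w₂)) → Bool) ≃ F × F) := by
    rw [← Fintype.card_eq]; simp [hF]; ring
  obtain ⟨e₂⟩ : Nonempty ((Fin (4 * (w₁ + w₂)) → Bool) ≃ (Fin 4 → F)) := by
    rw [← Fintype.card_eq]; simp [hF]; ring
  obtain ⟨α⟩ : Nonempty (Fin n ↪ F) := by
    rw [Function.Embedding.nonempty_iff_card_le]; simpa [hF] using hn
  have hk := (affine_hashFamily ψ).comp α.injective
  have hs := (cubic_signFamily h1 h2).comp α.injective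
  refine ⟨fun s i => ψ ((e₁ s).1 * α i + (e₁ s).2), fun s i => χ (cubic (e₂ s) (α i)),
    ⟨?_, fun i f => ?_, fun i j hij f => ?_⟩, ⟨fun s i => h1 _, fun i j k l hij hik hil => ?_⟩⟩
  · rw [Fintype.card_congr e₁]; exact hk.card
  · rw [← hk.sum_single i f]
    exact Equiv.sum_comp e₁ fun s => f (ψ (s.1 * α i + s.2))
  · rw [← hk.sum_pair i j hij f]
    exact Equiv.sum_comp e₁ fun s => f (ψ (s.1 * α i + s.2)) (ψ (s.1 * α j + s.2))
  · rw [← hs.orth i j k l hij hik hil]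
    exact Equiv.sum_comp e₂ fun s =>
      χ (cubic s (α i)) * χ (cubic s (α j)) * χ (cubic s (α k)) * χ (cubic s (α l))

/-! ### Markov's inequality, sampling and collision probabilities. -/

/-- Markov's inequality for a uniformly random element of a finite type. -/
theorem card_filter_lt_le {Ω : Type*} [Fintype Ω] {X : Ω → ℝ} {κ c : ℝ} (hX : ∀ s, 0 ≤ X s)
    (hc : 0 ≤ c) (hκ : 0 ≤ κ) (h : ∑ s, X s ≤ κ * c * Fintype.card Ω) :
    (#{s | c < X s} : ℝ) ≤ κ * Fintype.card Ω := by
  -- The threshold 0 does occur, for vectors with no tail; then every value of X vanishes.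
  rcases hc.eq_or_lt with rfl | hc
  · have h0 : ∑ s, X s = 0 :=
      le_antisymm (by simpa using h) (Finset.sum_nonneg fun s _ => hX s)
    rw [Finset.sum_eq_zero_iff_of_nonneg fun s _ => hX s] at h0
    rw [Finset.filter_false_of_mem fun s hs => by rw [h0 s hs]; exact lt_irrefl _]
    simp only [card_empty, Nat.cast_zero]
    positivity
  · have h1 : c * #{s | c < X s} ≤ ∑ s, X s := by
      calc c * (#{s | c < X s} : ℝ) = ∑ s with c < X s, c := by
            rw [Finset.sum_const, nsmul_eq_mul, mul_comm]
        _ ≤ ∑ s with c < X s, X s := Finset.sum_le_sum fun s hs => (mem_filter.1 hs).2.le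
        _ ≤ ∑ s, X s :=
          Finset.sum_le_sum_of_subset_of_nonneg (filter_subset _ _) fun s _ _ => hX s
    refine le_of_mul_le_mul_left ?_ hc
    linarith

/-- The coordinates with hash value `y` are sampled at level `ℓ`. -/
def Sampled {a b : ℕ} (ℓ : ℕ) (y : Fin a × Fin b) : Prop := y.1.val * 2 ^ ℓ < a

instance {a b : ℕ} (ℓ : ℕ) (y : Fin a × Fin b) : Decidable (Sampled ℓ y) :=
  inferInstanceAs (Decidable (_ < _))

/-- Both hash values are sampled at level `ℓ`, and fall into the same bucket. -/
def Collide {a b : ℕ} (ℓ : ℕ) (y y' : Fin a × Fin b) : Prop :=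
  Sampled ℓ y ∧ Sampled ℓ y' ∧ y.2 = y'.2

instance {a b : ℕ} (ℓ : ℕ) (y y' : Fin a × Fin b) : Decidable (Collide ℓ y y') :=
  inferInstanceAs (Decidable (_ ∧ _))

theorem card_sampled {w ℓ : ℕ} (h : ℓ ≤ w) :
    (∑ a : Fin (2 ^ w), if a.val * 2 ^ ℓ < 2 ^ w then (1 : ℝ) else 0) = 2 ^ w / 2 ^ ℓ := by
  rw [Fin.sum_univ_eq_sum_range (fun a => if a * 2 ^ ℓ < 2 ^ w then (1 : ℝ) else 0) (2 ^ w),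
    Finset.sum_ite, Finset.sum_const_zero, add_zero, Finset.sum_const, nsmul_eq_mul, mul_one]
  have e : (range (2 ^ w)).filter (fun a => a * 2 ^ ℓ < 2 ^ w) = range (2 ^ (w - ℓ)) := by
    ext a
    have h2 : 2 ^ w = 2 ^ (w - ℓ) * 2 ^ ℓ := by rw [← pow_add, Nat.sub_add_cancel h]
    have h3 : 2 ^ (w - ℓ) ≤ 2 ^ w := Nat.pow_le_pow_right (by norm_num) (Nat.sub_le _ _)
    have h4 : a * 2 ^ ℓ < 2 ^ w ↔ a < 2 ^ (w - ℓ) := by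
      rw [h2]; exact Nat.mul_lt_mul_right (by positivity)
    rw [mem_filter, mem_range, mem_range, h4]
    constructor
    · exact fun h => h.2
    · exact fun h => ⟨by omega, h⟩
  rw [e, card_range, Nat.cast_pow, eq_div_iff (by positivity)]
  rw [Nat.cast_ofNat, ← pow_add, Nat.sub_add_cancel h]

section Hash

variable {Ω : Type*} [Fintype Ω] {n w₁ w₂ ℓ : ℕ} {key : Ω → Fin n → Fin (2 ^ w₁) × Fin (2 ^ w₂)}

theorem IsHashFamily.card_eq (h : IsHashFamily key) :
    (Fintype.card Ω : ℝ) = (2 ^ w₁ * 2 ^ w₂) ^ 2 := by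
  rw [h.card]; simp

theorem sum_sampled_eq (hℓ : ℓ ≤ w₁) :
    (∑ y : Fin (2 ^ w₁) × Fin (2 ^ w₂), if Sampled ℓ y then (1 : ℝ) else 0) =
      2 ^ w₂ * (2 ^ w₁ / 2 ^ ℓ) := by
  rw [Fintype.sum_prod_type_right]
  refine (Finset.sum_congr rfl fun b _ => card_sampled hℓ).trans ?_
  simp

theorem IsHashFamily.sum_collide (h : IsHashFamily key) (hℓ : ℓ ≤ w₁) {i j : Fin n} (hij : i ≠ j) :
    (∑ s, if Collide ℓ (key s i) (key s j) then (1 : ℝ) else 0) =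
      1 / (4 ^ ℓ * 2 ^ w₂) * Fintype.card Ω := by
  rw [h.sum_pair i j hij fun y y' => if Collide ℓ y y' then (1 : ℝ) else 0]
  have e : ∀ y : Fin (2 ^ w₁) × Fin (2 ^ w₂), (∑ y', if Collide ℓ y y' then (1 : ℝ) else 0) =
      (if Sampled ℓ y then (1 : ℝ) else 0) * (2 ^ w₁ / 2 ^ ℓ) := by
    intro y
    rw [Fintype.sum_prod_type_right]
    have e' : ∀ b a, (if Collide ℓ y (a, b) then (1 : ℝ) else 0) =
        (if Sampled ℓ y then (1 : ℝ) else 0) * ((if y.2 = b then (1 : ℝ) else 0) *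
          if a.val * 2 ^ ℓ < 2 ^ w₁ then (1 : ℝ) else 0) := by
      intro b a
      unfold Collide Sampled
      by_cases h1 : y.1.val * 2 ^ ℓ < 2 ^ w₁ <;> by_cases h2 : a.val * 2 ^ ℓ < 2 ^ w₁ <;>
        by_cases h3 : y.2 = b <;> simp [h1, h2, h3]
    simp only [e', ← Finset.mul_sum, card_sampled hℓ]
    rw [← Finset.sum_mul]
    simp
  rw [Finset.sum_congr rfl fun y _ => e y, ← Finset.sum_mul, sum_sampled_eq hℓ,
    h.card_eq, show (4 : ℝ) = 2 * 2 by norm_num, mul_pow]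
  field_simp

theorem IsHashFamily.sum_sampled (h : IsHashFamily key) (hℓ : ℓ ≤ w₁) (i : Fin n) :
    (∑ s, ((if Sampled ℓ (key s i) then (1 : ℝ) else 0) - 1 / (2 : ℝ) ^ ℓ) ^ 2) ≤
      1 / (2 : ℝ) ^ ℓ * (Fintype.card Ω : ℝ) := by
  rw [h.sum_single i fun y => ((if Sampled ℓ y then (1 : ℝ) else 0) - 1 / (2 : ℝ) ^ ℓ) ^ 2]
  have e : ∀ y : Fin (2 ^ w₁) × Fin (2 ^ w₂),
      ((if Sampled ℓ y then (1 : ℝ) else 0) - 1 / (2 : ℝ) ^ ℓ) ^ 2 =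
      (1 - 2 * (1 / (2 : ℝ) ^ ℓ)) * (if Sampled ℓ y then (1 : ℝ) else 0)
        + (1 / (2 : ℝ) ^ ℓ) ^ 2 := by
    intro y
    split_ifs <;> ring
  rw [Finset.sum_congr rfl fun y _ => e y, Finset.sum_add_distrib, ← Finset.mul_sum,
    sum_sampled_eq hℓ, h.card_eq]
  simp only [Finset.sum_const, Finset.card_univ, nsmul_eq_mul, Fintype.card_fin, Fintype.card_prod]
  push_cast
  rw [← sub_nonneg]
  have : (1 : ℝ) / 2 ^ ℓ * (2 ^ w₁ * 2 ^ w₂) ^ 2 - 2 ^ w₁ * 2 ^ w₂ *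
      ((1 - 2 * (1 / 2 ^ ℓ)) * (2 ^ w₂ * (2 ^ w₁ / 2 ^ ℓ)) + 2 ^ w₁ * 2 ^ w₂ * (1 / 2 ^ ℓ) ^ 2) =
      (2 ^ w₁ * 2 ^ w₂ / 2 ^ ℓ) ^ 2 := by
    field_simp
    ring
  rw [this]
  positivity

theorem IsHashFamily.sum_sampled_mul (h : IsHashFamily key) (hℓ : ℓ ≤ w₁) {i j : Fin n}
    (hij : i ≠ j) :
    (∑ s, ((if Sampled ℓ (key s i) then (1 : ℝ) else 0) - 1 / (2 : ℝ) ^ ℓ) *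
      ((if Sampled ℓ (key s j) then (1 : ℝ) else 0) - 1 / (2 : ℝ) ^ ℓ)) = 0 := by
  rw [h.sum_pair i j hij fun y y' => ((if Sampled ℓ y then (1 : ℝ) else 0) - 1 / (2 : ℝ) ^ ℓ) *
    ((if Sampled ℓ y' then (1 : ℝ) else 0) - 1 / (2 : ℝ) ^ ℓ)]
  have e : ∑ y : Fin (2 ^ w₁) × Fin (2 ^ w₂),
      ((if Sampled ℓ y then (1 : ℝ) else 0) - 1 / (2 : ℝ) ^ ℓ) = 0 := by
    rw [Finset.sum_sub_distrib, sum_sampled_eq hℓ]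
    simp
    field_simp
    ring
  simp only [← Finset.mul_sum, e, mul_zero, Finset.sum_const_zero]

/-- The number of sampled elements of `T` at level `ℓ` is close to its expectation. -/
def SampleNear {a b : ℕ} (ℓ : ℕ) (T : Finset (Fin n)) (w : ℝ) (g : Fin n → Fin a × Fin b) : Prop :=
  |(#{i ∈ T | Sampled ℓ (g i)} : ℝ) - #T / (2 : ℝ) ^ ℓ| < w

open Classical in
theorem IsHashFamily.card_not_sampleNear (h : IsHashFamily key) (hℓ : ℓ ≤ w₁) (T : Finset (Fin n))
    {w κ : ℝ} (hw : 0 < w) (hκ : 2 * (#T / (2 : ℝ) ^ ℓ) ≤ κ * w ^ 2) :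
    (#{s | ¬ SampleNear ℓ T w (key s)} : ℝ) ≤ κ * Fintype.card Ω := by
  have hκ0 : 0 ≤ κ := by
    have : 0 ≤ κ * w ^ 2 := le_trans (by positivity) hκ
    exact nonneg_of_mul_nonneg_left this (by positivity)
  -- Chebyshev by pairwise independence. The threshold is w²/2 because failure means a deviation of
  -- at least w, while the Markov bound counts strict excess.
  have hX : ∑ s, (∑ i ∈ T, ((if Sampled ℓ (key s i) then (1 : ℝ) else 0) - 1 / (2 : ℝ) ^ ℓ)) ^ 2 ≤
      κ * (w ^ 2 / 2) * Fintype.card Ω := by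
    calc _ = ∑ i ∈ T, ∑ j ∈ T, ∑ s, ((if Sampled ℓ (key s i) then (1 : ℝ) else 0) - 1 / (2 : ℝ) ^ ℓ) *
          ((if Sampled ℓ (key s j) then (1 : ℝ) else 0) - 1 / (2 : ℝ) ^ ℓ) := by
          simp only [pow_two, Finset.sum_mul_sum]
          rw [Finset.sum_comm]
          exact Finset.sum_congr rfl fun i _ => Finset.sum_comm
      _ ≤ ∑ i ∈ T, 1 / (2 : ℝ) ^ ℓ * (Fintype.card Ω : ℝ) := by
        refine Finset.sum_le_sum fun i hi => ?_
        rw [Finset.sum_eq_single i (fun j _ hji => h.sum_sampled_mul hℓ (Ne.symm hji))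
          (fun hi' => absurd hi hi')]
        simpa only [pow_two] using h.sum_sampled hℓ i
      _ = (#T / (2 : ℝ) ^ ℓ) * (Fintype.card Ω : ℝ) := by
        rw [Finset.sum_const, nsmul_eq_mul]; ring
      _ ≤ _ := by gcongr; linarith
  refine le_trans ?_ (card_filter_lt_le (fun s => sq_nonneg _) (by positivity) hκ0 hX)
  refine Nat.cast_le.2 (Finset.card_le_card fun s hs => ?_)
  simp only [mem_filter, mem_univ, true_and, SampleNear, not_lt] at hs ⊢
  have e : ∑ i ∈ T, ((if Sampled ℓ (key s i) then (1 : ℝ) else 0) - 1 / (2 : ℝ) ^ ℓ) =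
      (#{i ∈ T | Sampled ℓ (key s i)} : ℝ) - #T / (2 : ℝ) ^ ℓ := by
    rw [Finset.sum_sub_distrib, Finset.sum_boole, Finset.sum_const, nsmul_eq_mul, mul_one_div]
  rw [e, ← sq_abs (_ - _)]
  have : w ^ 2 ≤ |(#{i ∈ T | Sampled ℓ (key s i)} : ℝ) - #T / (2 : ℝ) ^ ℓ| ^ 2 := by gcongr
  have : 0 < w ^ 2 := by positivity
  linarith

end Hash

/-! ### Bucket sums and isolation of the top coordinates. -/

section Buckets

variable {n a b : ℕ}

/-- The part of `z` that is sampled at level `ℓ` and hashed to bucket `c`. -/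
def bucketPart (ℓ : ℕ) (g : Fin n → Fin a × Fin b) (z : Fin n → ℝ) (c : Fin b) (i : Fin n) : ℝ :=
  if Sampled ℓ (g i) ∧ (g i).2 = c then z i else 0

/-- The signed sum of the part of `z` that is sampled at level `ℓ` and hashed to bucket `c`. -/
def bucketSum (ℓ : ℕ) (g : Fin n → Fin a × Fin b) (τ : Fin n → ℤ) (z : Fin n → ℝ) (c : Fin b) : ℝ :=
  ∑ i, τ i * bucketPart ℓ g z c i

/-- The vector `z` without its first `J` coordinates. -/
def dropFirst (J : ℕ) (z : Fin n → ℝ) (i : Fin n) : ℝ := if J ≤ i.val then z i else 0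

/-- At level `ℓ`, the first `J` coordinates of `z` fall into different buckets, and the noise that
the remaining coordinates cause is controlled by `e`. -/
structure Isolated (ℓ J : ℕ) (e : ℝ) (g : Fin n → Fin a × Fin b) (τ : Fin n → ℤ) (z : Fin n → ℝ) :
    Prop where
  inj : ∀ i j : Fin n, i.val < J → j.val < J → i ≠ j → ¬ Collide ℓ (g i) (g j)
  head : ∑ i, (if i.val < J ∧ Sampled ℓ (g i) then
    bucketSum ℓ g τ (dropFirst J z) (g i).2 ^ 2 else 0) ≤ e
  tail : ∑ c, ((bucketSum ℓ g τ (dropFirst J z) c ^ 2 - ∑ i, bucketPart ℓ g (dropFirst J z) c i ^ 2) ^ 2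
    + ((∑ i, bucketPart ℓ g (dropFirst J z) c i ^ 2) ^ 2
      - ∑ i, bucketPart ℓ g (dropFirst J z) c i ^ 4)) ≤ e ^ 2

theorem sum_sq_sq_sub_nonneg {ι : Type*} [Fintype ι] [DecidableEq ι] (y : ι → ℝ) :
    0 ≤ (∑ i, y i ^ 2) ^ 2 - ∑ i, y i ^ 4 := by
  have h := sum_offDiag_mul fun i => y i ^ 2
  have h2 : ∑ i, (y i ^ 2) ^ 2 = ∑ i, y i ^ 4 := Finset.sum_congr rfl fun i _ => by ring
  rw [← h2, ← h]
  exact Finset.sum_nonneg fun p _ => by positivity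

theorem sum_bucketPart_mul (ℓ : ℕ) (g : Fin n → Fin a × Fin b) (z : Fin n → ℝ) (i k : Fin n) :
    ∑ c, bucketPart ℓ g z c i ^ 2 * bucketPart ℓ g z c k ^ 2 =
      z i ^ 2 * z k ^ 2 * if Collide ℓ (g i) (g k) then 1 else 0 := by
  rw [Finset.sum_eq_single (g i).2]
  · unfold bucketPart Collide
    by_cases h1 : Sampled ℓ (g i) <;> by_cases h2 : Sampled ℓ (g k) <;>
      by_cases h3 : (g i).2 = (g k).2 <;> simp [h1, h2, h3, eq_comm]
  · intro c _ hc
    simp [bucketPart, Ne.symm hc]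
  · simp

theorem card_filter_val_lt (J : ℕ) : (#{i : Fin n | i.val < J}) ≤ J := by
  calc (#{i : Fin n | i.val < J}) ≤ #(range J) :=
        Finset.card_le_card_of_injOn (fun i => i.val) (by intro i hi; simpa using hi)
          (fun i _ j _ h => Fin.ext h)
    _ = J := card_range J

end Buckets

/-! ### Isolation holds with high probability. -/

section Probability

variable {Ω Ω' : Type*} [Fintype Ω] [Fintype Ω'] {n w₁ w₂ ℓ J : ℕ}
  {key : Ω → Fin n → Fin (2 ^ w₁) × Fin (2 ^ w₂)} {σ : Ω' → Fin n → ℤ}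

theorem sum_collisions_le (h : IsHashFamily key) (hℓ : ℓ ≤ w₁) (J : ℕ) :
    ∑ s : Ω × Ω', ∑ p ∈ (univ.filter fun i : Fin n => i.val < J).offDiag,
        (if Collide ℓ (key s.1 p.1) (key s.1 p.2) then (1 : ℝ) else 0) ≤
      J ^ 2 / (4 ^ ℓ * 2 ^ w₂) * Fintype.card (Ω × Ω') := by
  rw [Finset.sum_comm]
  have e : ∀ p ∈ (univ.filter fun i : Fin n => i.val < J).offDiag,
      ∑ s : Ω × Ω', (if Collide ℓ (key s.1 p.1) (key s.1 p.2) then (1 : ℝ) else 0) =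
        1 / (4 ^ ℓ * 2 ^ w₂) * Fintype.card (Ω × Ω') := by
    intro p hp
    rw [Fintype.sum_prod_type_right]
    refine (Finset.sum_congr rfl fun t _ => h.sum_collide hℓ (mem_offDiag.1 hp).2.2).trans ?_
    rw [Finset.sum_const, Finset.card_univ, nsmul_eq_mul, Fintype.card_prod]
    push_cast
    ring
  rw [Finset.sum_congr rfl e, Finset.sum_const, nsmul_eq_mul]
  have h1 : (#((univ.filter fun i : Fin n => i.val < J).offDiag) : ℝ) ≤ J ^ 2 := by
    have := card_filter_val_lt (n := n) J
    rw [offDiag_card]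
    exact_mod_cast (Nat.sub_le _ _).trans (by rw [pow_two]; exact Nat.mul_le_mul this this)
  have := mul_le_mul_of_nonneg_right h1
    (show (0 : ℝ) ≤ 1 / (4 ^ ℓ * 2 ^ w₂) * Fintype.card (Ω × Ω') by positivity)
  refine this.trans (le_of_eq ?_)
  ring

theorem sum_head_le (h : IsHashFamily key) (hσ : IsSignFamily σ) (hℓ : ℓ ≤ w₁) (z : Fin n → ℝ) :
    ∑ s : Ω × Ω', ∑ i, (if i.val < J ∧ Sampled ℓ (key s.1 i) then
        bucketSum ℓ (key s.1) (σ s.2) (dropFirst J z) (key s.1 i).2 ^ 2 else 0) ≤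
      J * (∑ i, dropFirst J z i ^ 2) / (4 ^ ℓ * 2 ^ w₂) * Fintype.card (Ω × Ω') := by
  have e1 : ∀ s : Ω, ∀ i : Fin n, (∑ t : Ω', if i.val < J ∧ Sampled ℓ (key s i) then
        bucketSum ℓ (key s) (σ t) (dropFirst J z) (key s i).2 ^ 2 else 0) =
      Fintype.card Ω' * ∑ k, if i.val < J then dropFirst J z k ^ 2 *
        (if Collide ℓ (key s i) (key s k) then 1 else 0) else 0 := by
    intro s i
    by_cases h1 : i.val < J ∧ Sampled ℓ (key s i)
    · simp only [h1, and_self, if_true, bucketSum]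
      rw [hσ.second_moment]
      congr 1
      refine Finset.sum_congr rfl fun k _ => ?_
      unfold bucketPart Collide
      by_cases h2 : Sampled ℓ (key s k) <;> by_cases h3 : (key s i).2 = (key s k).2 <;>
        simp [h1.2, h2, h3, eq_comm]
    · simp only [h1, if_false, Finset.sum_const_zero]
      symm
      rw [mul_eq_zero]
      right
      refine Finset.sum_eq_zero fun k _ => ?_
      unfold Collide
      by_cases h2 : i.val < J
      · have h3 : ¬ Sampled ℓ (key s i) := fun h => h1 ⟨h2, h⟩
        simp [h3]
      · simp [h2]
  have e2 : ∀ i k : Fin n, (∑ s, if i.val < J then dropFirst J z k ^ 2 *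
        (if Collide ℓ (key s i) (key s k) then (1 : ℝ) else 0) else 0) =
      if i.val < J then dropFirst J z k ^ 2 * (1 / (4 ^ ℓ * 2 ^ w₂) * Fintype.card Ω) else 0 := by
    intro i k
    by_cases h1 : i.val < J
    · simp only [h1, if_true]
      rw [← Finset.mul_sum]
      by_cases h2 : i = k
      · subst h2
        simp [dropFirst, Nat.not_le.2 h1]
      · rw [h.sum_collide hℓ h2]
    · simp [h1]
  calc _ = ∑ s, ∑ i, ∑ t : Ω', (if i.val < J ∧ Sampled ℓ (key s i) then
        bucketSum ℓ (key s) (σ t) (dropFirst J z) (key s i).2 ^ 2 else 0) := by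
        rw [Fintype.sum_prod_type]
        exact Finset.sum_congr rfl fun s _ => Finset.sum_comm
    _ = Fintype.card Ω' * ∑ i, ∑ k, ∑ s, (if i.val < J then dropFirst J z k ^ 2 *
        (if Collide ℓ (key s i) (key s k) then (1 : ℝ) else 0) else 0) := by
        simp only [e1, ← Finset.mul_sum]
        rw [Finset.sum_comm]
        congr 1
        exact Finset.sum_congr rfl fun i _ => Finset.sum_comm
    _ = (#{i : Fin n | i.val < J} : ℝ) * ((∑ i, dropFirst J z i ^ 2) / (4 ^ ℓ * 2 ^ w₂) *
        Fintype.card (Ω × Ω')) := by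
        have e3 : ∀ i : Fin n, (∑ k, if i.val < J then dropFirst J z k ^ 2 *
            (1 / (4 ^ ℓ * 2 ^ w₂) * (Fintype.card Ω : ℝ)) else 0) =
            if i.val < J then (∑ k, dropFirst J z k ^ 2) *
              (1 / (4 ^ ℓ * 2 ^ w₂) * Fintype.card Ω) else 0 := by
          intro i
          split_ifs
          · rw [Finset.sum_mul]
          · simp
        simp only [e2, e3]
        rw [← Finset.sum_filter, Finset.sum_const, nsmul_eq_mul, Fintype.card_prod]
        push_cast
        ring
    _ ≤ J * ((∑ i, dropFirst J z i ^ 2) / (4 ^ ℓ * 2 ^ w₂) * Fintype.card (Ω × Ω')) := by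
        have h1 : (#{i : Fin n | i.val < J} : ℝ) ≤ J := by exact_mod_cast card_filter_val_lt J
        have h2 : 0 ≤ ∑ i, dropFirst J z i ^ 2 := Finset.sum_nonneg fun i _ => sq_nonneg _
        gcongr
    _ = _ := by ring

/-- Given the hashing, the signs contribute twice the off-diagonal sum of products of squares and
the second summand contributes it once more. A product survives only if its two coordinates collide.
-/
theorem sum_tail_le (h : IsHashFamily key) (hσ : IsSignFamily σ) (hℓ : ℓ ≤ w₁) (z : Fin n → ℝ) :
    ∑ s : Ω × Ω', ∑ c, ((bucketSum ℓ (key s.1) (σ s.2) z c ^ 2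
        - ∑ i, bucketPart ℓ (key s.1) z c i ^ 2) ^ 2
      + ((∑ i, bucketPart ℓ (key s.1) z c i ^ 2) ^ 2 - ∑ i, bucketPart ℓ (key s.1) z c i ^ 4)) ≤
      3 * (∑ i, z i ^ 2) ^ 2 / (4 ^ ℓ * 2 ^ w₂) * Fintype.card (Ω × Ω') := by
  have e1 : ∀ s c, ∑ t : Ω', ((bucketSum ℓ (key s) (σ t) z c ^ 2
        - ∑ i, bucketPart ℓ (key s) z c i ^ 2) ^ 2
      + ((∑ i, bucketPart ℓ (key s) z c i ^ 2) ^ 2 - ∑ i, bucketPart ℓ (key s) z c i ^ 4)) =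
      3 * Fintype.card Ω' * ∑ p ∈ (univ : Finset (Fin n)).offDiag,
        bucketPart ℓ (key s) z c p.1 ^ 2 * bucketPart ℓ (key s) z c p.2 ^ 2 := by
    intro s c
    rw [sum_offDiag_mul fun i => bucketPart ℓ (key s) z c i ^ 2, Finset.sum_add_distrib]
    unfold bucketSum
    rw [hσ.fourth_moment, Finset.sum_const, Finset.card_univ, nsmul_eq_mul]
    have : ∑ i, (bucketPart ℓ (key s) z c i ^ 2) ^ 2 = ∑ i, bucketPart ℓ (key s) z c i ^ 4 :=
      Finset.sum_congr rfl fun i _ => by ring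
    rw [this]
    ring
  calc _ = ∑ s, ∑ c, ∑ t : Ω', ((bucketSum ℓ (key s) (σ t) z c ^ 2
        - ∑ i, bucketPart ℓ (key s) z c i ^ 2) ^ 2
      + ((∑ i, bucketPart ℓ (key s) z c i ^ 2) ^ 2 - ∑ i, bucketPart ℓ (key s) z c i ^ 4)) := by
        rw [Fintype.sum_prod_type]
        exact Finset.sum_congr rfl fun s _ => Finset.sum_comm
    _ = 3 * Fintype.card Ω' * ∑ p ∈ (univ : Finset (Fin n)).offDiag, ∑ s, ∑ c,
        bucketPart ℓ (key s) z c p.1 ^ 2 * bucketPart ℓ (key s) z c p.2 ^ 2 := by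
        simp only [e1, ← Finset.mul_sum]
        congr 1
        exact (Finset.sum_congr rfl fun s _ => Finset.sum_comm).trans Finset.sum_comm
    _ = 3 * Fintype.card Ω' * ∑ p ∈ (univ : Finset (Fin n)).offDiag,
        z p.1 ^ 2 * z p.2 ^ 2 * (1 / (4 ^ ℓ * 2 ^ w₂) * Fintype.card Ω) := by
        congr 1
        refine Finset.sum_congr rfl fun p hp => ?_
        simp only [sum_bucketPart_mul, ← Finset.mul_sum]
        rw [h.sum_collide hℓ (mem_offDiag.1 hp).2.2]
    _ = (3 / (4 ^ ℓ * 2 ^ w₂) * Fintype.card (Ω × Ω')) *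
        ((∑ i, z i ^ 2) ^ 2 - ∑ i, (z i ^ 2) ^ 2) := by
        rw [← sum_offDiag_mul fun i => z i ^ 2, ← Finset.sum_mul, Fintype.card_prod]
        push_cast
        ring
    _ ≤ (3 / (4 ^ ℓ * 2 ^ w₂) * Fintype.card (Ω × Ω')) * (∑ i, z i ^ 2) ^ 2 := by
        have : 0 ≤ ∑ i, (z i ^ 2) ^ 2 := Finset.sum_nonneg fun i _ => by positivity
        gcongr
        linarith
    _ = _ := by ring

open Classical in
-- With ρ = J²/(4^ℓ 2^w₂), Markov gives failure probabilities 2ρ, ρ/η and 3ρ/η² for the three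
-- conditions, in total at most 6ρ/η².
theorem card_not_isolated (h : IsHashFamily key) (hσ : IsSignFamily σ) (hℓ : ℓ ≤ w₁) (z : Fin n → ℝ)
    {η e κ : ℝ} (hJ : 1 ≤ J) (hη : 0 < η) (hη1 : η ≤ 1)
    (he : e = η * (∑ i, dropFirst J z i ^ 2) / J)
    (hκ : 6 * J ^ 2 / (4 ^ ℓ * 2 ^ w₂ * η ^ 2) ≤ κ) :
    (#{s : Ω × Ω' | ¬ Isolated ℓ J e (key s.1) (σ s.2) z} : ℝ) ≤ κ * Fintype.card (Ω × Ω') := by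
  set R := ∑ i, dropFirst J z i ^ 2 with hR
  have hR0 : 0 ≤ R := Finset.sum_nonneg fun i _ => sq_nonneg _
  have hJr : (1 : ℝ) ≤ J := by exact_mod_cast hJ
  have he0 : 0 ≤ e := by rw [he]; positivity
  set ρ : ℝ := J ^ 2 / (4 ^ ℓ * 2 ^ w₂) with hρ
  have hρ0 : 0 ≤ ρ := by positivity
  -- The number of collisions is an integer, so not exceeding 1/2 means that there are none.
  have b1 := card_filter_lt_le (Ω := Ω × Ω') (κ := 2 * ρ) (c := 1 / 2)
    (X := fun s => ∑ p ∈ (univ.filter fun i : Fin n => i.val < J).offDiag,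
        (if Collide ℓ (key s.1 p.1) (key s.1 p.2) then (1 : ℝ) else 0))
    (fun s => Finset.sum_nonneg fun p _ => by split_ifs <;> norm_num) (by norm_num) (by positivity)
    (by
      refine (sum_collisions_le h hℓ J).trans (le_of_eq ?_)
      rw [hρ]; ring)
  have b2 := card_filter_lt_le (Ω := Ω × Ω') (κ := ρ / η) (c := e)
    (X := fun s => ∑ i, (if i.val < J ∧ Sampled ℓ (key s.1 i) then
        bucketSum ℓ (key s.1) (σ s.2) (dropFirst J z) (key s.1 i).2 ^ 2 else 0))
    (fun s => Finset.sum_nonneg fun p _ => by split_ifs <;> positivity) he0 (by positivity)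
    (by
      refine (sum_head_le h hσ hℓ z).trans (le_of_eq ?_)
      rw [hρ, he, ← hR]; field_simp)
  have b3 := card_filter_lt_le (Ω := Ω × Ω') (κ := 3 * ρ / η ^ 2) (c := e ^ 2)
    (X := fun s => ∑ c, ((bucketSum ℓ (key s.1) (σ s.2) (dropFirst J z) c ^ 2
        - ∑ i, bucketPart ℓ (key s.1) (dropFirst J z) c i ^ 2) ^ 2
      + ((∑ i, bucketPart ℓ (key s.1) (dropFirst J z) c i ^ 2) ^ 2
        - ∑ i, bucketPart ℓ (key s.1) (dropFirst J z) c i ^ 4)))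
    (fun s => Finset.sum_nonneg fun p _ => add_nonneg (sq_nonneg _) (sum_sq_sq_sub_nonneg _))
    (by positivity) (by positivity)
    (by
      refine (sum_tail_le h hσ hℓ (dropFirst J z)).trans (le_of_eq ?_)
      rw [hρ, he, ← hR]; field_simp)
  have hsub : (univ.filter fun s : Ω × Ω' => ¬ Isolated ℓ J e (key s.1) (σ s.2) z) ⊆
      (univ.filter fun s : Ω × Ω' => (1 : ℝ) / 2 <
        ∑ p ∈ (univ.filter fun i : Fin n => i.val < J).offDiag,
        (if Collide ℓ (key s.1 p.1) (key s.1 p.2) then (1 : ℝ) else 0)) ∪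
      ((univ.filter fun s : Ω × Ω' => e < ∑ i, (if i.val < J ∧ Sampled ℓ (key s.1 i) then
        bucketSum ℓ (key s.1) (σ s.2) (dropFirst J z) (key s.1 i).2 ^ 2 else 0)) ∪
      (univ.filter fun s : Ω × Ω' => e ^ 2 < ∑ c, ((bucketSum ℓ (key s.1) (σ s.2) (dropFirst J z) c ^ 2
        - ∑ i, bucketPart ℓ (key s.1) (dropFirst J z) c i ^ 2) ^ 2
      + ((∑ i, bucketPart ℓ (key s.1) (dropFirst J z) c i ^ 2) ^ 2
        - ∑ i, bucketPart ℓ (key s.1) (dropFirst J z) c i ^ 4)))) := by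
    intro s hs
    by_contra hcon
    simp only [mem_union, mem_filter, mem_univ, true_and, not_or, not_lt] at hcon hs
    refine hs ⟨fun i j hi hj hij hcol => ?_, hcon.2.1, hcon.2.2⟩
    have h1 : (1 : ℝ) ≤ ∑ p ∈ (univ.filter fun i : Fin n => i.val < J).offDiag,
        (if Collide ℓ (key s.1 p.1) (key s.1 p.2) then (1 : ℝ) else 0) := by
      have := Finset.single_le_sum
        (f := fun p : Fin n × Fin n => if Collide ℓ (key s.1 p.1) (key s.1 p.2) then (1 : ℝ) else 0)
        (s := (univ.filter fun i : Fin n => i.val < J).offDiag)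
        (fun p _ => by split_ifs <;> norm_num)
        (show (i, j) ∈ (univ.filter fun i : Fin n => i.val < J).offDiag by simp [hi, hj, hij])
      simpa only [hcol, if_true] using this
    linarith [hcon.1]
  have hcard : (#{s : Ω × Ω' | ¬ Isolated ℓ J e (key s.1) (σ s.2) z} : ℝ) ≤
      2 * ρ * Fintype.card (Ω × Ω') + (ρ / η * Fintype.card (Ω × Ω')
        + 3 * ρ / η ^ 2 * Fintype.card (Ω × Ω')) := by
    refine le_trans ?_ (add_le_add b1 (add_le_add b2 b3))
    exact_mod_cast (Finset.card_le_card hsub).trans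
      ((Finset.card_union_le _ _).trans (Nat.add_le_add_left (Finset.card_union_le _ _) _))
  have hη2 : 2 * ρ + (ρ / η + 3 * ρ / η ^ 2) ≤ κ := by
    refine le_trans ?_ hκ
    have e1 : (6 : ℝ) * J ^ 2 / (4 ^ ℓ * 2 ^ w₂ * η ^ 2) = 6 * ρ / η ^ 2 := by
      rw [hρ]; field_simp
    rw [e1, le_div_iff₀ (by positivity)]
    have e2 : (2 * ρ + (ρ / η + 3 * ρ / η ^ 2)) * η ^ 2 = ρ * (2 * η ^ 2 + η + 3) := by
      field_simp
      ring
    rw [e2]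
    have e3 : 2 * η ^ 2 + η + 3 ≤ 6 := by nlinarith
    have := mul_le_mul_of_nonneg_left e3 hρ0
    linarith
  have := mul_le_mul_of_nonneg_right hη2 (Nat.cast_nonneg (α := ℝ) (Fintype.card (Ω × Ω')))
  linarith

end Probability
-- What isolation implies for the number of large buckets.
theorem add_sq_le_of_pos {ζ : ℝ} (hζ : 0 < ζ) (u v : ℝ) :
    (u + v) ^ 2 ≤ (1 + ζ) * u ^ 2 + (1 + 1 / ζ) * v ^ 2 := by
  have h : (1 + ζ) * u ^ 2 + (1 + 1 / ζ) * v ^ 2 - (u + v) ^ 2 = (ζ * u - v) ^ 2 / ζ := by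
    field_simp
    ring
  have : 0 ≤ (ζ * u - v) ^ 2 / ζ := by positivity
  linarith

section Isolated

variable {n a b ℓ J : ℕ} {e ζ : ℝ} {g : Fin n → Fin a × Fin b} {τ : Fin n → ℤ} {z : Fin n → ℝ}

theorem Isolated.noise_head (h : Isolated ℓ J e g τ z) {i : Fin n} (hi : i.val < J)
    (hs : Sampled ℓ (g i)) : bucketSum ℓ g τ (dropFirst J z) (g i).2 ^ 2 ≤ e := by
  refine le_trans ?_ h.head
  have := Finset.single_le_sum (s := univ) (f := fun i : Fin n => if i.val < J ∧ Sampled ℓ (g i) then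
    bucketSum ℓ g τ (dropFirst J z) (g i).2 ^ 2 else 0)
    (fun p _ => by split_ifs <;> positivity) (mem_univ i)
  simpa only [hi, hs, and_self, if_true] using this

/-- For the tail mass W of a bucket, with Q its sum of fourth powers, Q ≤ βW and W² - Q ≤ e² force W
≤ β + e: small coordinates cannot pile up. The squared signed sum is within e of W. -/
theorem Isolated.noise_tail (h : Isolated ℓ J e g τ z) (he : 0 ≤ e) {β : ℝ} (hβ0 : 0 ≤ β)
    (hβ : ∀ i : Fin n, J ≤ i.val → z i ^ 2 ≤ β) (c : Fin b) :
    bucketSum ℓ g τ (dropFirst J z) c ^ 2 ≤ β + 2 * e := by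
  set N := bucketSum ℓ g τ (dropFirst J z) with hN
  set W := ∑ i, bucketPart ℓ g (dropFirst J z) c i ^ 2 with hW
  set Q := ∑ i, bucketPart ℓ g (dropFirst J z) c i ^ 4 with hQ
  have hWQ : 0 ≤ W ^ 2 - Q := sum_sq_sq_sub_nonneg _
  have hc : (N c ^ 2 - W) ^ 2 + (W ^ 2 - Q) ≤ e ^ 2 := by
    refine le_trans ?_ h.tail
    exact Finset.single_le_sum (s := univ) (f := fun c => ((N c ^ 2 -
      ∑ i, bucketPart ℓ g (dropFirst J z) c i ^ 2) ^ 2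
      + ((∑ i, bucketPart ℓ g (dropFirst J z) c i ^ 2) ^ 2
        - ∑ i, bucketPart ℓ g (dropFirst J z) c i ^ 4)))
      (fun c _ => add_nonneg (sq_nonneg _) (sum_sq_sq_sub_nonneg _)) (mem_univ c)
  have h1 : N c ^ 2 - W ≤ e := by
    have : (N c ^ 2 - W) ^ 2 ≤ e ^ 2 := by linarith
    exact (abs_le_of_sq_le_sq' this he).2
  have h2 : Q ≤ β * W := by
    rw [hQ, hW, Finset.mul_sum]
    refine Finset.sum_le_sum fun i _ => ?_
    have : bucketPart ℓ g (dropFirst J z) c i ^ 2 ≤ β := by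
      unfold bucketPart dropFirst
      split_ifs with h1 h2
      · exact hβ i h2
      · simpa using hβ0
      · simpa using hβ0
    have := mul_le_mul_of_nonneg_right this (sq_nonneg (bucketPart ℓ g (dropFirst J z) c i))
    refine le_trans (le_of_eq ?_) this
    ring
  have h3 : W ≤ β + e := by
    by_contra hcon
    push Not at hcon
    have h4 : W ^ 2 ≤ β * W + e ^ 2 := by
      have := sq_nonneg (N c ^ 2 - W)
      linarith
    nlinarith
  linarith

theorem Isolated.bucketSum_head (h : Isolated ℓ J e g τ z) {i : Fin n} (hi : i.val < J)
    (hs : Sampled ℓ (g i)) :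
    bucketSum ℓ g τ z (g i).2 = τ i * z i + bucketSum ℓ g τ (dropFirst J z) (g i).2 := by
  have e1 : (τ i : ℝ) * z i = ∑ k, if k = i then (τ i : ℝ) * z i else 0 := by simp
  rw [e1]
  unfold bucketSum
  rw [← Finset.sum_add_distrib]
  refine Finset.sum_congr rfl fun k _ => ?_
  by_cases hk : k = i
  · subst hk
    simp [bucketPart, dropFirst, hs, Nat.not_le.2 hi]
  · rw [if_neg hk, zero_add]
    congr 1
    unfold bucketPart
    by_cases hk2 : Sampled ℓ (g k) ∧ (g k).2 = (g i).2
    · have hkJ : ¬ k.val < J := fun hkJ => h.inj k i hkJ hi hk ⟨hk2.1, hs, hk2.2⟩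
      simp [hk2, dropFirst, Nat.not_lt.1 hkJ]
    · simp only [hk2, if_false]

theorem bucketSum_eq_dropFirst {c : Fin b}
    (hc : ∀ i : Fin n, i.val < J → Sampled ℓ (g i) → (g i).2 ≠ c) :
    bucketSum ℓ g τ z c = bucketSum ℓ g τ (dropFirst J z) c := by
  unfold bucketSum
  refine Finset.sum_congr rfl fun k _ => ?_
  congr 1
  unfold bucketPart
  by_cases hk2 : Sampled ℓ (g k) ∧ (g k).2 = c
  · have hkJ : ¬ k.val < J := fun hkJ => hc k hkJ hk2.1 hk2.2
    simp [hk2, dropFirst, Nat.not_lt.1 hkJ]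
  · simp only [hk2, if_false]

/-- Sampled coordinates of rank at most `hi` occupy distinct buckets, and removing the noise from
such a bucket leaves the coordinate up to sign. -/
theorem Isolated.card_lower (h : Isolated ℓ J e g τ z) (hτ : ∀ i, τ i * τ i = 1) (hζ : 0 < ζ)
    {β : ℝ} {hi : ℕ} (hJ : hi ≤ J) (hβ : ∀ i : Fin n, i.val < hi → β ≤ z i ^ 2) :
    #{i : Fin n | i.val < hi ∧ Sampled ℓ (g i)} ≤
      #{c | β ≤ (1 + ζ) * bucketSum ℓ g τ z c ^ 2 + (1 + 1 / ζ) * e} := by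
  refine Finset.card_le_card_of_injOn (fun i => (g i).2) (fun i hmem => ?_)
    fun i hi' j hj' hij => ?_
  · simp only [coe_filter, mem_univ, true_and, Set.mem_ofPred_eq] at hmem ⊢
    have hiJ : i.val < J := by omega
    have h1 := h.bucketSum_head hiJ hmem.2
    have h2 := h.noise_head hiJ hmem.2
    have hτi : (τ i : ℝ) * τ i = 1 := by exact_mod_cast hτ i
    have h3 := add_sq_le_of_pos hζ (bucketSum ℓ g τ z (g i).2)
      (-bucketSum ℓ g τ (dropFirst J z) (g i).2)
    rw [h1] at h3
    have h4 : (τ i * z i + bucketSum ℓ g τ (dropFirst J z) (g i).2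
        + -bucketSum ℓ g τ (dropFirst J z) (g i).2) ^ 2 = z i ^ 2 := by
      calc _ = ((τ i : ℝ) * τ i) * z i ^ 2 := by ring
        _ = _ := by rw [hτi, one_mul]
    rw [h4, ← h1, neg_sq] at h3
    have h5 : (1 + 1 / ζ) * bucketSum ℓ g τ (dropFirst J z) (g i).2 ^ 2 ≤ (1 + 1 / ζ) * e := by
      gcongr
    linarith [hβ i hmem.1]
  · simp only [coe_filter, mem_univ, true_and, Set.mem_ofPred_eq] at hi' hj'
    by_contra hne
    exact h.inj i j (by omega) (by omega) hne ⟨hi'.2, hj'.2, hij⟩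

/-- A bucket above the threshold must contain a sampled coordinate among the first `l`: one holding
a later head coordinate, or only tail, is too small. -/
theorem Isolated.card_upper (h : Isolated ℓ J e g τ z) (hτ : ∀ i, τ i * τ i = 1) (hζ : 0 < ζ)
    (hζ1 : ζ ≤ 1) (he : 0 ≤ e) {β : ℝ} {l : ℕ} (hl : l ≤ J) (hβ0 : 0 ≤ β)
    (hβ : ∀ i : Fin n, l ≤ i.val → z i ^ 2 ≤ β) :
    #{c | (1 + ζ) * β + (1 + 1 / ζ) * e < bucketSum ℓ g τ z c ^ 2} ≤
      #{i : Fin n | i.val < l ∧ Sampled ℓ (g i)} := by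
  refine le_trans (Finset.card_le_card ?_)
    (Finset.card_image_le (s := univ.filter fun i : Fin n => i.val < l ∧ Sampled ℓ (g i))
      (f := fun i => (g i).2))
  intro c hc
  simp only [mem_filter, mem_univ, true_and, mem_image] at hc ⊢
  by_contra hcon
  push Not at hcon
  -- This makes 1 + 1/ζ ≥ 2, which covers the 2e in the noise of buckets without a head coordinate.
  have hζ2 : 1 ≤ 1 / ζ := by rw [le_div_iff₀ hζ]; linarith
  refine absurd hc (not_lt.2 ?_)
  by_cases hx : ∃ i : Fin n, i.val < J ∧ Sampled ℓ (g i) ∧ (g i).2 = c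
  · obtain ⟨i, hiJ, his, rfl⟩ := hx
    have hil : l ≤ i.val := by
      by_contra hil
      exact hcon i ⟨by omega, his⟩ rfl
    rw [h.bucketSum_head hiJ his]
    refine (add_sq_le_of_pos hζ _ _).trans ?_
    have hτi : (τ i : ℝ) * τ i = 1 := by exact_mod_cast hτ i
    have h4 : (τ i * z i) ^ 2 = z i ^ 2 := by
      calc _ = ((τ i : ℝ) * τ i) * z i ^ 2 := by ring
        _ = _ := by rw [hτi, one_mul]
    rw [h4]
    have h5 := hβ i hil
    have h6 := h.noise_head hiJ his
    gcongr
  · push Not at hx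
    rw [bucketSum_eq_dropFirst (J := J) fun i h1 h2 => hx i h1 h2]
    refine (h.noise_tail he hβ0 (fun i hi => hβ i (by omega)) c).trans ?_
    have h1 := mul_le_mul_of_nonneg_right hζ2 he
    have h2 := mul_nonneg hζ.le hβ0
    linarith

end Isolated

/-! ### From common bucket values to mutual domination. -/

/-- The bucket values `v` agree with the sequence `b` of squares between the ranks `lo` and `hi`: at
least `t` buckets are about as large as `b hi`, and fewer than `t` are much larger than `b lo`. -/
def Agrees {B : ℕ} (n : ℕ) (ζ μ : ℝ) (v : Fin B → ℝ) (b : ℕ → ℝ) (t hi lo J : ℕ) : Prop :=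
  t ≤ #{c | b hi ≤ (1 + ζ) * v c ^ 2 + μ * tailSum n b J / J} ∧
    #{c | (1 + ζ) * b lo + μ * tailSum n b J / J < v c ^ 2} < t

/-- At least t buckets are large for b and fewer than t are too large for b'; a bucket of the first
kind that is not of the second compares the two sequences. -/
theorem Agrees.le {B n : ℕ} {ζ μ : ℝ} {v : Fin B → ℝ} {b b' : ℕ → ℝ} {t hi lo J : ℕ} (hζ : 0 ≤ ζ)
    (h : Agrees n ζ μ v b t hi lo J) (h' : Agrees n ζ μ v b' t hi lo J) :
    b hi ≤ (1 + ζ) * ((1 + ζ) * b' lo + μ * tailSum n b' J / J) + μ * tailSum n b J / J := by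
  obtain ⟨c, hc1, hc2⟩ := Finset.exists_mem_notMem_of_card_lt_card (h'.2.trans_le h.1)
  simp only [mem_filter, mem_univ, true_and, not_lt] at hc1 hc2
  have := mul_le_mul_of_nonneg_left hc2 (show 0 ≤ 1 + ζ by linarith)
  linarith

/-- The bucket values of all levels agree with the sequence `b` of squares. -/
def Consistent {L B : ℕ} (n N w : ℕ) (ζ μ : ℝ) (v : Fin (L + 1) → Fin B → ℝ) (b : ℕ → ℝ) : Prop :=
  (∀ t, 1 ≤ t → t ≤ 2 * N * w → Agrees n ζ μ (v 0) b t t t (4 * t)) ∧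
    ∀ (ℓ : Fin (L + 1)) (u : ℕ), 2 ≤ u → u ≤ 2 * N → Agrees n ζ μ (v ℓ) b (u * w)
      ((u + 1) * w * 2 ^ ℓ.val) ((u - 1) * w * 2 ^ ℓ.val) (4 * (u * w * 2 ^ ℓ.val))

theorem Agrees.dominated {B n M : ℕ} {ζ μ η : ℝ} {v : Fin B → ℝ} {b b' : ℕ → ℝ} {t hi lo J j : ℕ}
    (hζ : 0 ≤ ζ) (hζM : (1 + ζ) ^ 2 ≤ 1 + 1 / M) (hM : 1 ≤ M) (hμ : 0 ≤ μ) (hμη : 2 * μ ≤ η)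
    (h0 : ∀ i, 0 ≤ b i) (ha : ∀ i j, 1 ≤ i → i ≤ j → b j ≤ b i)
    (h0' : ∀ i, 0 ≤ b' i) (ha' : ∀ i j, 1 ≤ i → i ≤ j → b' j ≤ b' i)
    (h : Agrees n ζ μ v b t hi lo J) (h' : Agrees n ζ μ v b' t hi lo J)
    (hhi : 1 ≤ hi) (hhi' : hi ≤ j) (hlo : 1 ≤ j - j / M) (hlo' : j - j / M ≤ lo) (hJ : 2 * j ≤ J) :
    b j ≤ (1 + 1 / M) * b' (j - j / M) + η / j * (tailSum n b (2 * j) + tailSum n b' (2 * j)) := by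
  have h1 := h.le hζ h'
  have h2 := ha hi j hhi hhi'
  have h3 := ha' (j - j / M) lo hlo hlo'
  have hj : 1 ≤ j := hhi.trans hhi'
  have hj0 : (0 : ℝ) < j := by exact_mod_cast hj
  have hjJ : (j : ℝ) ≤ J := by exact_mod_cast (show j ≤ J by omega)
  have hMr : (1 : ℝ) ≤ M := by exact_mod_cast hM
  have hM1 : 1 / (M : ℝ) ≤ 1 := by rw [div_le_one (by linarith)]; exact hMr
  have hζ1 : 1 + ζ ≤ 2 := by nlinarith
  have t1 : μ * tailSum n b J / J ≤ μ * tailSum n b (2 * j) / j := by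
    have := tailSum_nonneg (n := n) h0 (2 * j)
    have := tailSum_anti (n := n) h0 hJ
    gcongr
  have t2 : μ * tailSum n b' J / J ≤ μ * tailSum n b' (2 * j) / j := by
    have := tailSum_nonneg (n := n) h0' (2 * j)
    have := tailSum_anti (n := n) h0' hJ
    gcongr
  have n1 : 0 ≤ tailSum n b (2 * j) / j := div_nonneg (tailSum_nonneg h0 _) hj0.le
  have n2 : 0 ≤ tailSum n b' (2 * j) / j := div_nonneg (tailSum_nonneg h0' _) hj0.le
  have t3 : (1 + ζ) * (μ * tailSum n b' J / J) ≤ η * (tailSum n b' (2 * j) / j) := by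
    have g1 : 0 ≤ μ * tailSum n b' (2 * j) / j := by rw [mul_div_assoc]; exact mul_nonneg hμ n2
    calc (1 + ζ) * (μ * tailSum n b' J / J) ≤ (1 + ζ) * (μ * tailSum n b' (2 * j) / j) := by gcongr
      _ ≤ 2 * (μ * tailSum n b' (2 * j) / j) := by gcongr
      _ = 2 * μ * (tailSum n b' (2 * j) / j) := by ring
      _ ≤ _ := by gcongr
  have t4 : μ * tailSum n b J / J ≤ η * (tailSum n b (2 * j) / j) := by
    calc μ * tailSum n b J / J ≤ μ * (tailSum n b (2 * j) / j) := by rw [← mul_div_assoc]; exact t1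
      _ ≤ _ := by
        have : μ ≤ η := by linarith
        gcongr
  have t5 : (1 + ζ) * ((1 + ζ) * b' lo) ≤ (1 + 1 / M) * b' (j - j / M) := by
    calc (1 + ζ) * ((1 + ζ) * b' lo) = (1 + ζ) ^ 2 * b' lo := by ring
      _ ≤ _ := by
        have := h0' lo
        gcongr
  have e : η / j * (tailSum n b (2 * j) + tailSum n b' (2 * j)) =
      η * (tailSum n b (2 * j) / j) + η * (tailSum n b' (2 * j) / j) := by ring
  rw [e]
  linarith

theorem Consistent.dominated {L B n M w : ℕ} {ζ μ η : ℝ} {v : Fin (L + 1) → Fin B → ℝ}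
    {b b' : ℕ → ℝ} (hζ : 0 ≤ ζ) (hζM : (1 + ζ) ^ 2 ≤ 1 + 1 / M) (hM : 2 ≤ M) (hw : 1 ≤ w)
    (hL : n ≤ 2 ^ L) (hμ : 0 ≤ μ) (hμη : 2 * μ ≤ η)
    (h0 : ∀ i, 0 ≤ b i) (ha : ∀ i j, 1 ≤ i → i ≤ j → b j ≤ b i)
    (h0' : ∀ i, 0 ≤ b' i) (ha' : ∀ i j, 1 ≤ i → i ≤ j → b' j ≤ b' i)
    (h : Consistent n (3 * M) w ζ μ v b) (h' : Consistent n (3 * M) w ζ μ v b') :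
    Dominated n M η b b' := by
  intro j hj hjn
  have hlo := sub_div_pos hM hj
  rcases le_or_gt j (2 * (3 * M) * w) with hs | hs
  · exact (h.1 j hj hs).dominated hζ hζM (by omega) hμ hμη h0 ha h0' ha' (h'.1 j hj hs) hj le_rfl hlo
      (Nat.sub_le _ _) (by omega)
  -- The level is chosen so that, in units of r = w·2^ℓ, the rank j has integer part U between 3M
  -- and 6M. Then three units are at most j/M.
  · set q := 3 * M * w with hq
    have hq1 : 1 ≤ q := by rw [hq]; exact Nat.mul_pos (by omega) hw
    have hjq : 1 ≤ j / q := (Nat.one_le_div_iff hq1).2 (by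
      rw [show 2 * (3 * M) * w = 2 * q by rw [hq]; ring] at hs; omega)
    set ℓ := Nat.log 2 (j / q) with hℓ
    have p1 : 2 ^ ℓ ≤ j / q := Nat.pow_log_le_self 2 (by omega)
    have p2 : j / q < 2 ^ (ℓ + 1) := Nat.lt_pow_succ_log_self (by norm_num) _
    have p3 : 2 ^ ℓ * q ≤ j := (Nat.le_div_iff_mul_le hq1).1 p1
    have p4 : j < 2 ^ (ℓ + 1) * q := (Nat.div_lt_iff_lt_mul hq1).1 p2
    have hℓL : ℓ < L + 1 := by
      by_contra hcon
      have : 2 ^ (L + 1) ≤ 2 ^ ℓ := Nat.pow_le_pow_right (by norm_num) (by omega)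
      have : 2 ^ ℓ ≤ j := by nlinarith
      have : 2 ^ L < 2 ^ (L + 1) := Nat.pow_lt_pow_right (by norm_num) (by omega)
      omega
    set r := w * 2 ^ ℓ with hr
    have hr1 : 1 ≤ r := Nat.mul_pos hw (by positivity)
    set U := j / r with hU
    have u1 : U * r ≤ j := Nat.div_mul_le_self j r
    have u2 : j < (U + 1) * r := by
      have := Nat.lt_div_mul_add (a := j) hr1
      rwa [← hU, ← Nat.succ_mul] at this
    have e1 : 2 ^ ℓ * q = 3 * M * r := by rw [hq, hr]; ring
    have e2 : 2 ^ (ℓ + 1) * q = 6 * M * r := by rw [hq, hr, pow_succ]; ring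
    rw [e1] at p3
    rw [e2] at p4
    have U1 : 3 * M ≤ U := (Nat.le_div_iff_mul_le hr1).2 p3
    have U2 : U < 6 * M := (Nat.div_lt_iff_lt_mul hr1).2 p4
    -- With u = U - 1 the upper rank U·r is at most j, the lower rank (U - 2)·r exceeds j - 3r,
    -- hence is at least the shifted rank, and J = 4(U - 1)r is at least 2j.
    have k1 := h.2 ⟨ℓ, hℓL⟩ (U - 1) (by omega) (by omega)
    have k2 := h'.2 ⟨ℓ, hℓL⟩ (U - 1) (by omega) (by omega)
    have f1 : (U - 1 + 1) * w * 2 ^ ℓ = U * r := by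
      rw [Nat.sub_add_cancel (by omega), hr, mul_assoc]
    have f2 : (U - 1 - 1) * w * 2 ^ ℓ = (U - 2) * r := by rw [hr, mul_assoc]; rfl
    have f3 : 4 * ((U - 1) * w * 2 ^ ℓ) = 4 * ((U - 1) * r) := by rw [hr, mul_assoc]
    dsimp only at k1 k2
    rw [f1, f2, f3] at k1 k2
    have hdiv : 3 * r ≤ j / M := by
      rw [Nat.le_div_iff_mul_le (by omega)]
      calc 3 * r * M = 3 * M * r := by ring
        _ ≤ j := p3
    clear_value U
    obtain ⟨V, rfl⟩ : ∃ V, U = V + 2 := ⟨U - 2, by omega⟩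
    refine k1.dominated hζ hζM (by omega) hμ hμη h0 ha h0' ha' k2 ?_ u1 hlo ?_ ?_
    · exact Nat.mul_pos (by omega) hr1
    · rw [Nat.add_sub_cancel]
      have : (V + 2 + 1) * r = V * r + 3 * r := by ring
      omega
    · have g1 : V + 2 - 1 = V + 1 := by omega
      rw [g1]
      have g2 : 2 * ((V + 2 + 1) * r) ≤ 4 * ((V + 1) * r) := by
        have : 2 * ((V + 2 + 1) * r) + 2 * ((V - 1) * r) = 4 * ((V + 1) * r) := by
          obtain ⟨V', rfl⟩ : ∃ V', V = V' + 1 := ⟨V - 1, by omega⟩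
          rw [Nat.add_sub_cancel]; ring
        omega
      omega

/-! ### Sorted coordinates and their squares. -/

section Sorted

variable {n : ℕ}

/-- The permutation that sorts the coordinates by non-increasing absolute value. -/
def sortPerm (x : Fin n → ℤ) : Equiv.Perm (Fin n) := Tuple.sort fun j => -|x j|

theorem sorted_succ (x : Fin n → ℤ) (i : Fin n) : sorted x (i.val + 1) = x (sortPerm x i) := by
  have hi := i.isLt
  rw [sorted, dif_pos ⟨by omega, by omega⟩]
  rfl

theorem sorted_of_lt (x : Fin n → ℤ) {i : ℕ} (h : n < i) : sorted x i = 0 := by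
  rw [sorted, dif_neg (by omega)]

theorem abs_sorted_anti (x : Fin n → ℤ) {i j : ℕ} (hi : 1 ≤ i) (hij : i ≤ j) :
    |sorted x j| ≤ |sorted x i| := by
  rcases le_or_gt j n with hj | hj
  · have h := Tuple.monotone_sort (fun j => -|x j|)
    have h1 := h (show (⟨i - 1, by omega⟩ : Fin n) ≤ ⟨j - 1, by omega⟩ by
      rw [Fin.mk_le_mk]; omega)
    rw [sorted, dif_pos ⟨by omega, hj⟩, sorted, dif_pos ⟨hi, by omega⟩]
    simpa using h1
  · rw [sorted_of_lt x hj, abs_zero]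
    exact abs_nonneg _

/-- The squares of the sorted coordinates. -/
def sortedSq (x : Fin n → ℤ) (i : ℕ) : ℝ := (sorted x i : ℝ) ^ 2

theorem sortedSq_nonneg (x : Fin n → ℤ) (i : ℕ) : 0 ≤ sortedSq x i := sq_nonneg _

theorem sortedSq_anti (x : Fin n → ℤ) (i j : ℕ) (hi : 1 ≤ i) (hij : i ≤ j) :
    sortedSq x j ≤ sortedSq x i := by
  unfold sortedSq
  rw [sq_le_sq]
  exact_mod_cast abs_sorted_anti x hi hij

theorem sortedSq_of_lt (x : Fin n → ℤ) {i : ℕ} (h : n < i) : sortedSq x i = 0 := by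
  simp [sortedSq, sorted_of_lt x h]

theorem tailSum_sortedSq (x : Fin n → ℤ) (J : ℕ) : tailSum n (sortedSq x) J = (residualSq x J : ℝ) := by
  simp [tailSum, residualSq, sortedSq]

theorem tailSum_eq_sum_dropFirst {b : ℕ → ℝ} {z : Fin n → ℝ} (hz : ∀ i : Fin n, b (i.val + 1) = z i ^ 2)
    (J : ℕ) : tailSum n b J = ∑ i, dropFirst J z i ^ 2 := by
  have e1 : ∀ i : Fin n, dropFirst J z i ^ 2 = if J ≤ i.val then b (i.val + 1) else 0 := by
    intro i
    unfold dropFirst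
    rw [hz]
    split_ifs <;> ring
  rw [Finset.sum_congr rfl fun i _ => e1 i,
    Fin.sum_univ_eq_sum_range (fun i => if J ≤ i then b (i + 1) else 0) n, ← Finset.sum_filter]
  unfold tailSum
  refine (Finset.sum_bij (fun i _ => i + 1) ?_ ?_ ?_ ?_).symm
  · intro i hi; simp only [mem_filter, mem_range, mem_Ioc] at hi ⊢; omega
  · intro i _ j _ h; omega
  · intro j hj
    rw [mem_Ioc] at hj
    exact ⟨j - 1, by simp only [mem_filter, mem_range]; omega, by omega⟩
  · intro i _; rfl

end Sorted

/-! ### Consistency of the true vector with its own bucket values. -/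

section Consistency

variable {n a B ℓ J : ℕ} {g : Fin n → Fin a × Fin B} {τ : Fin n → ℤ} {z : Fin n → ℝ} {b : ℕ → ℝ}

theorem Isolated.agrees {ζ η μ : ℝ} {t hi lo : ℕ}
    (h : Isolated ℓ J (η * (∑ i, dropFirst J z i ^ 2) / J) g τ z) (hτ : ∀ i, τ i * τ i = 1)
    (hζ : 0 < ζ) (hζ1 : ζ ≤ 1) (hη : 0 ≤ η) (hμ : μ = (1 + 1 / ζ) * η)
    (hz : ∀ i : Fin n, b (i.val + 1) = z i ^ 2) (h0 : ∀ i, 0 ≤ b i)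
    (ha : ∀ i j, 1 ≤ i → i ≤ j → b j ≤ b i) (hn : ∀ i, n < i → b i = 0)
    (htB : t ≤ B) (hhi : hi ≤ J) (hlo : 1 ≤ lo) (hloJ : lo ≤ J)
    (hlower : hi ≤ n → t ≤ #{i : Fin n | i.val < hi ∧ Sampled ℓ (g i)})
    (hupper : #{i : Fin n | i.val < lo - 1 ∧ Sampled ℓ (g i)} < t) :
    Agrees n ζ μ (bucketSum ℓ g τ z) b t hi lo J := by
  have hR : 0 ≤ ∑ i, dropFirst J z i ^ 2 := Finset.sum_nonneg fun i _ => sq_nonneg _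
  have he : μ * tailSum n b J / J = (1 + 1 / ζ) * (η * (∑ i, dropFirst J z i ^ 2) / J) := by
    rw [tailSum_eq_sum_dropFirst hz, hμ]; ring
  have he0 : 0 ≤ η * (∑ i, dropFirst J z i ^ 2) / J := by positivity
  unfold Agrees
  rw [he]
  constructor
  · rcases le_or_gt hi n with hhn | hhn
    · refine (hlower hhn).trans (h.card_lower hτ hζ hhi fun i hi' => ?_)
      rw [← hz]
      exact ha _ _ (by omega) (by omega)
    -- Beyond rank n the sequence vanishes, so every bucket qualifies and it is enough that there
    -- are at least t of them.
    · rw [Finset.filter_true_of_mem]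
      · simpa using htB
      · intro c _
        rw [hn hi hhn]
        positivity
  -- Ranks start at 1 and coordinates at 0, so the coordinates before rank `lo` are the first lo -
  -- 1.
  · refine lt_of_le_of_lt (h.card_upper hτ hζ hζ1 he0 (l := lo - 1) (by omega) (h0 lo) fun i hi' => ?_)
      hupper
    rw [← hz]
    exact ha _ _ hlo (by omega)

theorem sampled_zero {a b : ℕ} (y : Fin a × Fin b) : Sampled 0 y := by
  unfold Sampled; rw [pow_zero, mul_one]; exact y.1.isLt

theorem card_filter_val_lt_eq {n J : ℕ} (h : J ≤ n) : #{i : Fin n | i.val < J} = J := by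
  refine le_antisymm (card_filter_val_lt J) ?_
  calc J = #(univ : Finset (Fin J)) := by simp
    _ ≤ _ := Finset.card_le_card_of_injOn (fun i => Fin.castLE h i) (fun i _ => by simp)
        fun i _ j _ hij => Fin.castLE_injective h hij

theorem consistent_of_isolated {L N w : ℕ} {ζ η μ : ℝ}
    (hτ : ∀ i, τ i * τ i = 1)
    (hζ : 0 < ζ) (hζ1 : ζ ≤ 1) (hη : 0 ≤ η) (hμ : μ = (1 + 1 / ζ) * η) (hw : 1 ≤ w)
    (hz : ∀ i : Fin n, b (i.val + 1) = z i ^ 2) (h0 : ∀ i, 0 ≤ b i)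
    (ha : ∀ i j, 1 ≤ i → i ≤ j → b j ≤ b i) (hn : ∀ i, n < i → b i = 0)
    (hB : 2 * N * w ≤ B)
    (hiso : ∀ ℓ ∈ range (L + 1), ∀ t ∈ Icc 1 (2 * N * w), Isolated ℓ (4 * (t * 2 ^ ℓ))
      (η * (∑ i, dropFirst (4 * (t * 2 ^ ℓ)) z i ^ 2) / ((4 * (t * 2 ^ ℓ) : ℕ) : ℝ)) g τ z)
    (hnear : ∀ ℓ ∈ range (L + 1), ∀ u ∈ range (2 * N + 2),
      SampleNear ℓ (univ.filter fun i : Fin n => i.val < u * w * 2 ^ ℓ) w g) :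
    Consistent n N w ζ μ (fun (ℓ : Fin (L + 1)) => bucketSum ℓ.val g τ z) b := by
  constructor
  · intro t ht1 ht2
    -- At level 0 every coordinate is sampled and the counts are exact, so no window around t is
    -- needed.
    have h := hiso 0 (by simp) t (mem_Icc.2 ⟨ht1, ht2⟩)
    rw [pow_zero, mul_one] at h
    refine h.agrees hτ hζ hζ1 hη hμ hz h0 ha hn (ht2.trans hB) (by omega) ht1 (by omega)
      (fun htn => ?_) ?_
    · simp only [sampled_zero, and_true]
      exact (card_filter_val_lt_eq htn).ge
    · simp only [sampled_zero, and_true]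
      exact (card_filter_val_lt (n := n) (t - 1)).trans_lt (by omega)
  · intro ℓ u hu1 hu2
    have hℓ : ℓ.val ∈ range (L + 1) := mem_range.2 ℓ.isLt
    have htB : u * w ≤ 2 * N * w := Nat.mul_le_mul_right w hu2
    have huw : 1 ≤ u * w := Nat.mul_pos (by omega) hw
    have hP : (0 : ℝ) < 2 ^ ℓ.val := by positivity
    have h := hiso ℓ.val hℓ (u * w) (mem_Icc.2 ⟨huw, htB⟩)
    -- A deviation below w separates the sample counts at u ± 1 from the threshold u·w on either
    -- side.
    have n1 := hnear ℓ.val hℓ (u + 1) (mem_range.2 (by omega))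
    have n2 := hnear ℓ.val hℓ (u - 1) (mem_range.2 (by omega))
    unfold SampleNear at n1 n2
    rw [abs_lt, Finset.filter_filter] at n1 n2
    have hmul : (u + 1) * w * 2 ^ ℓ.val ≤ 4 * (u * w * 2 ^ ℓ.val) := by
      have : u + 1 ≤ 4 * u := by omega
      calc (u + 1) * w * 2 ^ ℓ.val ≤ 4 * u * w * 2 ^ ℓ.val := by gcongr
        _ = _ := by ring
    have hmul2 : (u - 1) * w * 2 ^ ℓ.val ≤ (u + 1) * w * 2 ^ ℓ.val := by gcongr; omega
    refine h.agrees hτ hζ hζ1 hη hμ hz h0 ha hn (htB.trans hB) hmul ?_ (hmul2.trans hmul)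
      (fun hhn => ?_) ?_
    · exact Nat.mul_pos (Nat.mul_pos (by omega) hw) (by positivity)
    · rw [card_filter_val_lt_eq hhn] at n1
      have e : (((u + 1) * w * 2 ^ ℓ.val : ℕ) : ℝ) / 2 ^ ℓ.val = u * w + w := by
        push_cast; field_simp
      rw [e] at n1
      have : ((u * w : ℕ) : ℝ) < #{i : Fin n | i.val < (u + 1) * w * 2 ^ ℓ.val ∧ Sampled ℓ.val (g i)} := by
        push_cast; linarith [n1.1]
      exact (Nat.cast_lt.1 this).le
    · have c1 : #{i : Fin n | i.val < (u - 1) * w * 2 ^ ℓ.val - 1 ∧ Sampled ℓ.val (g i)} ≤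
          #{i : Fin n | i.val < (u - 1) * w * 2 ^ ℓ.val ∧ Sampled ℓ.val (g i)} := by
        refine Finset.card_le_card fun i hi => ?_
        simp only [mem_filter, mem_univ, true_and] at hi ⊢
        exact ⟨by omega, hi.2⟩
      refine c1.trans_lt ?_
      have c2 : ((#{i : Fin n | i.val < (u - 1) * w * 2 ^ ℓ.val} : ℕ) : ℝ) / 2 ^ ℓ.val ≤ u * w - w := by
        rw [div_le_iff₀ hP]
        have : ((#{i : Fin n | i.val < (u - 1) * w * 2 ^ ℓ.val} : ℕ) : ℝ) ≤
            (((u - 1) * w * 2 ^ ℓ.val : ℕ) : ℝ) := Nat.cast_le.2 (card_filter_val_lt _)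
        refine this.trans (le_of_eq ?_)
        rw [Nat.cast_mul, Nat.cast_mul, Nat.cast_sub (by omega)]
        push_cast
        ring
      have : (#{i : Fin n | i.val < (u - 1) * w * 2 ^ ℓ.val ∧ Sampled ℓ.val (g i)} : ℝ) < ((u * w : ℕ) : ℝ) := by
        push_cast; linarith [n2.2]
      exact Nat.cast_lt.1 this

theorem card_exists_le {Ω α : Type*} [Fintype Ω] [DecidableEq Ω] (A : Finset α) (P : α → Ω → Prop)
    [∀ i, DecidablePred (P i)] {κ : ℝ} (h : ∀ i ∈ A, (#{s | P i s} : ℝ) ≤ κ) :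
    (#(A.biUnion fun i => univ.filter (P i)) : ℝ) ≤ #A * κ := by
  have h2 : (#(A.biUnion fun i => univ.filter (P i)) : ℝ) ≤ ∑ i ∈ A, (#{s | P i s} : ℝ) := by
    exact_mod_cast Finset.card_biUnion_le
  refine h2.trans ((Finset.sum_le_sum h).trans (le_of_eq ?_))
  rw [Finset.sum_const, nsmul_eq_mul]

/-- Lets the analysis relabel coordinates by decreasing absolute value, although the sketch does not
know that order. -/
theorem bucketSum_comp_perm (ℓ : ℕ) (g : Fin n → Fin a × Fin B) (τ : Fin n → ℤ) (z : Fin n → ℝ)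
    (π : Equiv.Perm (Fin n)) :
    bucketSum ℓ (fun i => g (π i)) (fun i => τ (π i)) (fun i => z (π i)) = bucketSum ℓ g τ z := by
  funext c
  exact Equiv.sum_comp π fun i => (τ i : ℝ) * bucketPart ℓ g z c i

section Union

variable {Ω Ω' : Type*} [Fintype Ω] [Fintype Ω'] {w₁ w₂ N w : ℕ}
  {key : Ω → Fin n → Fin (2 ^ w₁) × Fin (2 ^ w₂)} {σ : Ω' → Fin n → ℤ}

/-- Isolation at level `ℓ` of enough top coordinates for finding the `t`-th largest bucket. -/
def IsolatedAt (η : ℝ) (z : Fin n → ℝ) (g : Fin n → Fin a × Fin B) (τ : Fin n → ℤ) (p : ℕ × ℕ) :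
    Prop :=
  Isolated p.1 (4 * (p.2 * 2 ^ p.1))
    (η * (∑ i, dropFirst (4 * (p.2 * 2 ^ p.1)) z i ^ 2) / ((4 * (p.2 * 2 ^ p.1) : ℕ) : ℝ)) g τ z

/-- The number of samples at level `ℓ` among the first `u w 2 ^ ℓ` coordinates is nearly `u w`. -/
def SampleNearAt (w : ℕ) (g : Fin n → Fin a × Fin B) (p : ℕ × ℕ) : Prop :=
  SampleNear p.1 (univ.filter fun i : Fin n => i.val < p.2 * w * 2 ^ p.1) w g

open Classical in
theorem card_not_isolatedAt (h : IsHashFamily key) (hσ : IsSignFamily σ) (z : Fin n → ℝ) {η : ℝ}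
    (hη : 0 < η) (hη1 : η ≤ 1) {p : ℕ × ℕ} (hp : p ∈ range (w₁ + 1) ×ˢ Icc 1 (2 * N * w)) :
    (#{s : Ω × Ω' | ¬ IsolatedAt η z (key s.1) (σ s.2) p} : ℝ) ≤
      384 * (N * w) ^ 2 / (2 ^ w₂ * η ^ 2) * Fintype.card (Ω × Ω') := by
  obtain ⟨ℓ, t⟩ := p
  simp only [mem_product, mem_range, mem_Icc] at hp
  refine card_not_isolated h hσ (by omega) z (Nat.mul_pos (by norm_num)
    (Nat.mul_pos hp.2.1 (by positivity))) hη hη1 rfl ?_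
  have ht : (t : ℝ) ≤ 2 * N * w := by exact_mod_cast hp.2.2
  -- Both sides of the collision trade-off scale by 4^ℓ, so the level disappears.
  have e : 6 * (((4 * (t * 2 ^ ℓ) : ℕ) : ℝ)) ^ 2 / (4 ^ ℓ * 2 ^ w₂ * η ^ 2) =
      96 * (t : ℝ) ^ 2 / (2 ^ w₂ * η ^ 2) := by
    rw [show (4 : ℝ) ^ ℓ = (2 ^ ℓ) ^ 2 by rw [← pow_mul, mul_comm, pow_mul]; norm_num]
    push_cast
    field_simp
    ring
  dsimp only
  rw [e]
  have ht2 : (t : ℝ) ^ 2 ≤ (2 * N * w) ^ 2 := by gcongr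
  have ht3 : 96 * (t : ℝ) ^ 2 ≤ 384 * (N * w) ^ 2 := by linarith
  exact div_le_div_of_nonneg_right ht3 (by positivity)

open Classical in
theorem card_not_sampleNearAt (h : IsHashFamily key) (hw : 1 ≤ w) {p : ℕ × ℕ}
    (hp : p ∈ range (w₁ + 1) ×ˢ range (2 * N + 2)) :
    (#{s : Ω × Ω' | ¬ SampleNearAt w (key s.1) p} : ℝ) ≤
      2 * (2 * N + 1) / w * Fintype.card (Ω × Ω') := by
  obtain ⟨ℓ, u⟩ := p
  simp only [mem_product, mem_range] at hp
  have hwr : (1 : ℝ) ≤ w := by exact_mod_cast hw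
  have hb := h.card_not_sampleNear (ℓ := ℓ) (by omega)
    (univ.filter fun i : Fin n => i.val < u * w * 2 ^ ℓ) (w := w)
    (κ := 2 * (2 * N + 1) / w) (by linarith) (by
      have c1 : ((#{i : Fin n | i.val < u * w * 2 ^ ℓ} : ℕ) : ℝ) / 2 ^ ℓ ≤ u * w := by
        rw [div_le_iff₀ (by positivity)]
        exact_mod_cast card_filter_val_lt (n := n) (u * w * 2 ^ ℓ)
      have c2 : (u : ℝ) ≤ 2 * N + 1 := by exact_mod_cast (show u ≤ 2 * N + 1 by omega)
      have c3 : 2 * (2 * (N : ℝ) + 1) / w * (w : ℝ) ^ 2 = 2 * ((2 * N + 1) * w) := by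
        field_simp
      rw [c3]
      have : (u : ℝ) * w ≤ (2 * N + 1) * w := by gcongr
      linarith)
  have e : (univ.filter fun s : Ω × Ω' => ¬ SampleNearAt w (key s.1) (ℓ, u)) =
      (univ.filter fun s : Ω => ¬ SampleNear ℓ
      (univ.filter fun i : Fin n => i.val < u * w * 2 ^ ℓ) w (key s)) ×ˢ univ := by
    ext s; simp [SampleNearAt]
  rw [e, card_product, Fintype.card_prod, Finset.card_univ]
  push_cast
  rw [← mul_assoc]
  gcongr

open Classical in
-- Union bound over all levels, all thresholds t for isolation and all multiples u for sample
-- counts. Sorting permutes the coordinates by a fixed bijection, which preserves both random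
-- families.
theorem card_not_consistent (h : IsHashFamily key) (hσ : IsSignFamily σ) (x : Fin n → ℤ)
    {ζ η μ δ : ℝ}
    (hζ : 0 < ζ) (hζ1 : ζ ≤ 1) (hη : 0 < η) (hη1 : η ≤ 1) (hμ : μ = (1 + 1 / ζ) * η) (hw : 1 ≤ w)
    (hB : 2 * N * w ≤ 2 ^ w₂)
    (hδ : (w₁ + 1) * (2 * N * w) * (384 * (N * w) ^ 2 / (2 ^ w₂ * η ^ 2))
      + (w₁ + 1) * (2 * N + 2) * (2 * (2 * N + 1) / w) ≤ δ) :
    (#{s : Ω × Ω' | ¬ Consistent n N w ζ μ (fun (ℓ : Fin (w₁ + 1)) =>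
      bucketSum ℓ.val (key s.1) (σ s.2) fun i => (x i : ℝ)) (sortedSq x)} : ℝ) ≤
      δ * Fintype.card (Ω × Ω') := by
  set π := sortPerm x with hπ
  have hk := h.comp (g := π) π.injective
  have hs := hσ.comp (g := π) π.injective
  have b1 := card_exists_le (range (w₁ + 1) ×ˢ Icc 1 (2 * N * w))
    (fun p (s : Ω × Ω') => ¬ IsolatedAt η (fun i => (x (π i) : ℝ))
      (fun i => key s.1 (π i)) (fun i => σ s.2 (π i)) p)
    fun p hp => card_not_isolatedAt hk hs (fun i => (x (π i) : ℝ)) hη hη1 hp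
  have b2 := card_exists_le (range (w₁ + 1) ×ˢ range (2 * N + 2))
    (fun p (s : Ω × Ω') => ¬ SampleNearAt w (fun i => key s.1 (π i)) p)
    fun p hp => card_not_sampleNearAt hk hw hp
  have hgood : ∀ s : Ω × Ω',
      (∀ p ∈ range (w₁ + 1) ×ˢ Icc 1 (2 * N * w), IsolatedAt η (fun i => (x (π i) : ℝ))
        (fun i => key s.1 (π i)) (fun i => σ s.2 (π i)) p) →
      (∀ p ∈ range (w₁ + 1) ×ˢ range (2 * N + 2), SampleNearAt w (fun i => key s.1 (π i)) p) →
      Consistent n N w ζ μ (fun (ℓ : Fin (w₁ + 1)) =>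
        bucketSum ℓ.val (key s.1) (σ s.2) fun i => (x i : ℝ)) (sortedSq x) := by
    intro s h1 h2
    have hcons := consistent_of_isolated (L := w₁) (b := sortedSq x) (N := N) (w := w)
      (z := fun i => (x (π i) : ℝ)) (g := fun i => key s.1 (π i)) (fun i => hs.mul_self s.2 i)
      hζ hζ1 hη.le hμ hw
      (fun i => by rw [sortedSq, sorted_succ, hπ]) (sortedSq_nonneg x) (sortedSq_anti x)
      (fun i hi => sortedSq_of_lt x hi) hB
      (fun ℓ hℓ t ht => h1 (ℓ, t) (mk_mem_product hℓ ht))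
      (fun ℓ hℓ u hu => h2 (ℓ, u) (mk_mem_product hℓ hu))
    have e : ∀ ℓ, bucketSum ℓ (fun i => key s.1 (π i)) (fun i => σ s.2 (π i))
        (fun i => (x (π i) : ℝ)) =
        bucketSum ℓ (key s.1) (σ s.2) fun i => (x i : ℝ) := fun ℓ =>
      bucketSum_comp_perm ℓ (key s.1) (σ s.2) (fun i => (x i : ℝ)) π
    simpa only [e] using hcons
  have hcard := (Finset.card_le_card (fun s hsm => by
    rw [mem_union, mem_biUnion, mem_biUnion]
    by_contra hcon
    push Not at hcon
    refine (mem_filter.1 hsm).2 (hgood s (fun p hp => ?_) (fun p hp => ?_))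
    · by_contra hc
      exact hcon.1 p hp (mem_filter.2 ⟨mem_univ s, hc⟩)
    · by_contra hc
      exact hcon.2 p hp (mem_filter.2 ⟨mem_univ s, hc⟩) :
    (univ.filter fun s : Ω × Ω' => ¬ Consistent n N w ζ μ (fun (ℓ : Fin (w₁ + 1)) =>
      bucketSum ℓ.val (key s.1) (σ s.2) fun i => (x i : ℝ)) (sortedSq x)) ⊆
      ((range (w₁ + 1) ×ˢ Icc 1 (2 * N * w)).biUnion fun p => univ.filter
        fun s : Ω × Ω' => ¬ IsolatedAt η (fun i => (x (π i) : ℝ))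
          (fun i => key s.1 (π i)) (fun i => σ s.2 (π i)) p) ∪
      ((range (w₁ + 1) ×ˢ range (2 * N + 2)).biUnion fun p => univ.filter
        fun s : Ω × Ω' => ¬ SampleNearAt w (fun i => key s.1 (π i)) p))).trans
    (Finset.card_union_le _ _)
  have hcard' := (Nat.cast_le (α := ℝ)).2 hcard
  rw [Nat.cast_add] at hcard'
  refine hcard'.trans ((add_le_add b1 b2).trans ?_)
  rw [card_product, card_product, card_range, card_range, Nat.card_Icc, Nat.add_sub_cancel]
  have := mul_le_mul_of_nonneg_right hδ (Nat.cast_nonneg (α := ℝ) (Fintype.card (Ω × Ω')))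
  refine le_trans (le_of_eq ?_) this
  push_cast
  ring

end Union
end Consistency

/-! ### From the heaviness hypothesis to the tail condition at k. -/

section Admissibility

variable {n : ℕ}

theorem topMoment_eq (x : Fin n → ℤ) (p : ℝ) (k : ℕ) :
    topMoment x p k = ∑ i ∈ Icc 1 k, sortedSq x i ^ (p / 2) := by
  unfold topMoment sortedSq
  refine Finset.sum_congr rfl fun i _ => ?_
  rw [← sq_abs, ← Real.rpow_natCast, ← Real.rpow_mul (abs_nonneg _)]
  congr 1
  push_cast
  ring

theorem IsIndex.le {x : Fin n → ℤ} {k : ℕ} (h : IsIndex x k) : k ≤ n := by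
  by_contra hcon
  have h1 : (k : ℤ) ≤ |sorted x k| := h.1
  rw [sorted_of_lt x (by omega), abs_zero] at h1
  omega

theorem IsIndex.sortedSq_le {x : Fin n → ℤ} {k : ℕ} (h : IsIndex x k) {j : ℕ} (hj : k < j) :
    sortedSq x j ≤ (k : ℝ) ^ 2 := by
  refine (sortedSq_anti x (k + 1) j (by omega) hj).trans ?_
  have h1 : |sorted x (k + 1)| ≤ (k : ℤ) := by
    by_contra hcon
    have : k + 1 ≤ k := h.2 (show ((k + 1 : ℕ) : ℤ) ≤ |sorted x (k + 1)| by push_cast; omega)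
    omega
  unfold sortedSq
  rw [← sq_abs]
  have h2 : |(sorted x (k + 1) : ℝ)| ≤ k := by exact_mod_cast h1
  gcongr

theorem IsIndex.admissible {x : Fin n → ℤ} {k : ℕ} {θ : ℝ} (h : IsIndex x k)
    (hθ : θ * tailSum n (sortedSq x) k ≤ k * sortedSq x k) : Admissible n θ (sortedSq x) k where
  nonneg := sortedSq_nonneg x
  anti := sortedSq_anti x
  le := h.le
  ge_index _ := by
    have h1 : (k : ℤ) ≤ |sorted x k| := h.1
    have h2 : (k : ℝ) ≤ |(sorted x k : ℝ)| := by exact_mod_cast h1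
    unfold sortedSq
    rw [← sq_abs (sorted x k : ℝ)]
    gcongr
  le_index _ hj := h.sortedSq_le hj
  tail_le := hθ

/-- Between k and q = ⌊(1 + ε)k⌋ there are at most k terms, each at most b_k. After q the hypothesis
bounds the tail by 2k·b_k/θ; with θ ≤ 1 the total is at most 3k·b_k/θ. -/
theorem tailSum_le_of_heavy {x : Fin n → ℤ} {k : ℕ} {ε θ ϑ : ℝ} (h : IsIndex x k) (hε : 0 < ε)
    (hε1 : ε < 1) (hθ0 : 0 ≤ θ) (hθ1 : θ ≤ 1) (hϑ : θ ≤ ϑ)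
    (hx : (sorted x ⌊(1 + ε) * (k : ℝ)⌋₊ : ℝ) ^ 2 ≥
      ϑ * ((residualSq x ⌊(1 + ε) * (k : ℝ)⌋₊ : ℝ) / ((1 + ε) * (k : ℝ)))) :
    θ / 3 * tailSum n (sortedSq x) k ≤ k * sortedSq x k := by
  rcases Nat.eq_zero_or_pos k with rfl | hk
  · have : tailSum n (sortedSq x) 0 = 0 := by
      refine Finset.sum_eq_zero fun j hj => ?_
      have := h.sortedSq_le (mem_Ioc.1 hj).1
      simp only [Nat.cast_zero, ne_eq, OfNat.ofNat_ne_zero, not_false_eq_true, zero_pow] at this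
      exact le_antisymm this (sortedSq_nonneg x j)
    rw [this]; simp
  have hkr : (1 : ℝ) ≤ k := by exact_mod_cast hk
  set q := ⌊(1 + ε) * (k : ℝ)⌋₊ with hq
  have hqle : (q : ℝ) ≤ (1 + ε) * k := Nat.floor_le (by positivity)
  have hkq : k ≤ q := Nat.le_floor (by nlinarith)
  have hpos : 0 < (1 + ε) * (k : ℝ) := by positivity
  rw [← tailSum_sortedSq, ge_iff_le, ← mul_div_assoc, div_le_iff₀ hpos] at hx
  have hR : 0 ≤ tailSum n (sortedSq x) q := tailSum_nonneg (sortedSq_nonneg x) q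
  have hbk := sortedSq_nonneg x k
  have h1 : θ * tailSum n (sortedSq x) q ≤ 2 * (k * sortedSq x k) := by
    calc θ * tailSum n (sortedSq x) q ≤ ϑ * tailSum n (sortedSq x) q := by gcongr
      _ ≤ sortedSq x q * ((1 + ε) * k) := hx
      _ ≤ sortedSq x k * (2 * k) := by
        gcongr
        · exact sortedSq_anti x k q hk hkq
        · linarith
      _ = _ := by ring
  have h2 : tailSum n (sortedSq x) k ≤ k * sortedSq x k + tailSum n (sortedSq x) q := by
    have e1 : tailSum n (sortedSq x) k ≤ ∑ j ∈ Ioc k q ∪ Ioc q n, sortedSq x j := by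
      refine Finset.sum_le_sum_of_subset_of_nonneg (fun j => ?_) fun j _ _ => sortedSq_nonneg x j
      simp only [mem_Ioc, mem_union]
      omega
    rw [Finset.sum_union (by
      rw [Finset.disjoint_left]; intro j; simp only [mem_Ioc]; omega)] at e1
    have e2 : ∑ j ∈ Ioc k q, sortedSq x j ≤ k * sortedSq x k := by
      have : ∑ j ∈ Ioc k q, sortedSq x j ≤ ∑ j ∈ Ioc k q, sortedSq x k :=
        Finset.sum_le_sum fun j hj => sortedSq_anti x k j hk (mem_Ioc.1 hj).1.le
      rw [Finset.sum_const, Nat.card_Ioc, nsmul_eq_mul, Nat.cast_sub hkq] at this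
      refine this.trans ?_
      have : (q : ℝ) - k ≤ k := by nlinarith
      gcongr
    unfold tailSum at e1 ⊢
    linarith
  have h3 := mul_le_mul_of_nonneg_left h2 hθ0
  have h4 : θ * (k * sortedSq x k) ≤ 1 * (k * sortedSq x k) := by gcongr
  linarith

end Admissibility

/-! ### The sketch, its decoder and its correctness. -/

section Sketch

variable {n w₁ w₂ : ℕ}

/-- The matrix that computes the bucket sums of all levels. -/
def bucketMatrix (g : Fin n → Fin (2 ^ w₁) × Fin (2 ^ w₂)) (τ : Fin n → ℤ) :
    Matrix (Fin ((w₁ + 1) * 2 ^ w₂)) (Fin n) ℤ := fun r i =>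
  if Sampled (finProdFinEquiv.symm r).1.val (g i) ∧ (g i).2 = (finProdFinEquiv.symm r).2 then τ i
  else 0

theorem bucketMatrix_mulVec (g : Fin n → Fin (2 ^ w₁) × Fin (2 ^ w₂)) (τ : Fin n → ℤ) (x : Fin n → ℤ)
    (ℓ : Fin (w₁ + 1)) (c : Fin (2 ^ w₂)) :
    (((bucketMatrix g τ).mulVec x (finProdFinEquiv (ℓ, c)) : ℤ) : ℝ) =
      bucketSum ℓ.val g τ (fun i => (x i : ℝ)) c := by
  simp only [bucketMatrix, Matrix.mulVec, dotProduct, Equiv.symm_apply_apply, bucketSum, bucketPart]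
  push_cast
  refine Finset.sum_congr rfl fun i _ => ?_
  split_ifs <;> simp

theorem abs_bucketMatrix_mulVec_le (g : Fin n → Fin (2 ^ w₁) × Fin (2 ^ w₂)) {τ : Fin n → ℤ}
    (hτ : ∀ i, τ i * τ i = 1) {x : Fin n → ℤ} {m : ℕ} (hx : ∀ i, |x i| ≤ (m : ℤ))
    (r : Fin ((w₁ + 1) * 2 ^ w₂)) : |(bucketMatrix g τ).mulVec x r| ≤ n * m := by
  unfold Matrix.mulVec dotProduct
  refine (Finset.abs_sum_le_sum_abs _ _).trans ?_
  have : ∀ i ∈ (univ : Finset (Fin n)), |bucketMatrix g τ r i * x i| ≤ (m : ℤ) := by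
    intro i _
    rw [abs_mul]
    have h2 : |bucketMatrix g τ r i| ≤ 1 := by
      unfold bucketMatrix
      split_ifs
      · rcases mul_self_eq_one_iff.1 (hτ i) with h | h <;> rw [h] <;> simp
      · simp
    calc _ ≤ 1 * |x i| := by gcongr
      _ ≤ m := by rw [one_mul]; exact hx i
  refine (Finset.sum_le_sum this).trans (le_of_eq ?_)
  simp

open Classical in
/-- The sketch that stores the bucket sums of all levels. The decoder looks for a vector that is
consistent with all of them, and outputs its moment. -/
noncomputable def bucketSketch (key : (Fin (2 * (w₁ + w₂)) → Bool) → Fin n → Fin (2 ^ w₁) × Fin (2 ^ w₂))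
    (σ : (Fin (4 * (w₁ + w₂)) → Bool) → Fin n → ℤ) (wordBits N w : ℕ) (ζ μ θ p : ℝ) :
    LinearSketch n where
  seedBits := 2 * (w₁ + w₂) + 4 * (w₁ + w₂)
  rows := (w₁ + 1) * 2 ^ w₂
  wordBits := wordBits
  matrix s := bucketMatrix (key ((Fin.appendEquiv _ _).symm s).1) (σ ((Fin.appendEquiv _ _).symm s).2)
  decode _ y :=
    if h : ∃ q : (Fin n → ℤ) × ℕ, IsIndex q.1 q.2 ∧
        θ * tailSum n (sortedSq q.1) q.2 ≤ q.2 * sortedSq q.1 q.2 ∧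
        Consistent n N w ζ μ (fun (ℓ : Fin (w₁ + 1)) (c : Fin (2 ^ w₂)) =>
          (y (finProdFinEquiv (ℓ, c)) : ℝ)) (sortedSq q.1) then
      topMoment h.choose.1 p h.choose.2 else 0

variable {key : (Fin (2 * (w₁ + w₂)) → Bool) → Fin n → Fin (2 ^ w₁) × Fin (2 ^ w₂)}
  {σ : (Fin (4 * (w₁ + w₂)) → Bool) → Fin n → ℤ} {wordBits N w M : ℕ} {ζ μ θ p : ℝ}

theorem bucketSketch_fitsOn {m γ : ℕ} (hσ : ∀ s i, σ s i * σ s i = 1) (hn : n ≤ 2 ^ w₁)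
    (hm : m ≤ n ^ γ) :
    (bucketSketch key σ ((γ + 1) * w₁ + 2) N w ζ μ θ p).FitsOn m := by
  intro s x hx r
  have h1 := abs_bucketMatrix_mulVec_le (key ((Fin.appendEquiv _ _).symm s).1)
    (fun i => hσ ((Fin.appendEquiv _ _).symm s).2 i) hx r
  have h2 : n * m ≤ 2 ^ ((γ + 1) * w₁) := by
    calc n * m ≤ n * n ^ γ := by gcongr
      _ = n ^ (γ + 1) := by ring
      _ ≤ (2 ^ w₁) ^ (γ + 1) := by gcongr
      _ = _ := by rw [← pow_mul, mul_comm]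
  have h3 : (n : ℤ) * m ≤ 2 ^ ((γ + 1) * w₁) := by exact_mod_cast h2
  have h4 : (0 : ℤ) < 2 ^ ((γ + 1) * w₁) := by positivity
  change 2 * |(bucketMatrix (key ((Fin.appendEquiv _ _).symm s).1)
    (σ ((Fin.appendEquiv _ _).symm s).2)).mulVec x r| < (2 : ℤ) ^ ((γ + 1) * w₁ + 2)
  rw [pow_add]
  linarith

theorem Consistent.moment_le {L B k k' : ℕ} {v : Fin (L + 1) → Fin B → ℝ} {x x' : Fin n → ℤ} {η H : ℝ}
    (hM : 4 ≤ M) (hζ : 0 ≤ ζ) (hζM : (1 + ζ) ^ 2 ≤ 1 + 1 / M) (hw : 1 ≤ w)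
    (hL : n ≤ 2 ^ L) (hμ : 0 ≤ μ) (hμη : 2 * μ ≤ η)
    (hη : 0 ≤ η) (hH : ∑ j ∈ Icc 1 n, (1 : ℝ) / j ≤ H) (hηH : η * H ≤ 1 / 4) (hθ : 0 < θ)
    (hθ1 : θ ≤ 1) (hηθ : 7 * η * M ≤ θ) (hηHθ : 42 * η * H * M ^ 2 ≤ θ) (hp0 : 0 ≤ p) (hp2 : p ≤ 2)
    (hx : Admissible n θ (sortedSq x) k) (hx' : Admissible n θ (sortedSq x') k')
    (h : Consistent n (3 * M) w ζ μ v (sortedSq x))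
    (h' : Consistent n (3 * M) w ζ μ v (sortedSq x')) :
    topMoment x' p k' ≤ (1 + 16 / M) * topMoment x p k := by
  rw [topMoment_eq, topMoment_eq]
  have d1 := h.dominated hζ hζM (by omega) hw hL hμ hμη hx.nonneg hx.anti hx'.nonneg hx'.anti h'
  have d2 := h'.dominated hζ hζM (by omega) hw hL hμ hμη hx'.nonneg hx'.anti hx.nonneg hx.anti h
  exact d1.moment_le hM hη hH hηH hθ hθ1 hηθ hηHθ (by linarith) (by linarith) hx hx' d2

/-- The true vector is itself a candidate, so the search succeeds. The chosen candidate may be a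
different vector, but mutual domination makes the moments agree up to 1 + 16/M in both directions.
-/
theorem bucketSketch_output {k : ℕ} {x : Fin n → ℤ} {η H ε : ℝ}
    (hM : 4 ≤ M) (hζ : 0 ≤ ζ) (hζM : (1 + ζ) ^ 2 ≤ 1 + 1 / M) (hw : 1 ≤ w)
    (hL : n ≤ 2 ^ w₁) (hμ : 0 ≤ μ) (hμη : 2 * μ ≤ η)
    (hη : 0 ≤ η) (hH : ∑ j ∈ Icc 1 n, (1 : ℝ) / j ≤ H) (hηH : η * H ≤ 1 / 4) (hθ : 0 < θ)
    (hθ1 : θ ≤ 1) (hηθ : 7 * η * M ≤ θ) (hηHθ : 42 * η * H * M ^ 2 ≤ θ) (hp0 : 0 ≤ p) (hp2 : p ≤ 2)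
    (hε : 16 / M ≤ ε) (hk : IsIndex x k)
    (hx : θ * tailSum n (sortedSq x) k ≤ k * sortedSq x k)
    (s : Fin (2 * (w₁ + w₂) + 4 * (w₁ + w₂)) → Bool)
    (h : Consistent n (3 * M) w ζ μ (fun (ℓ : Fin (w₁ + 1)) =>
      bucketSum ℓ.val (key ((Fin.appendEquiv _ _).symm s).1) (σ ((Fin.appendEquiv _ _).symm s).2)
        fun i => (x i : ℝ)) (sortedSq x)) :
    |(bucketSketch key σ wordBits (3 * M) w ζ μ θ p).output x s - topMoment x p k| ≤
      ε * topMoment x p k := by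
  set g := key ((Fin.appendEquiv _ _).symm s).1
  set τ := σ ((Fin.appendEquiv _ _).symm s).2
  have e : (fun (ℓ : Fin (w₁ + 1)) (c : Fin (2 ^ w₂)) =>
      (((bucketMatrix g τ).mulVec x (finProdFinEquiv (ℓ, c)) : ℤ) : ℝ)) =
      fun (ℓ : Fin (w₁ + 1)) => bucketSum ℓ.val g τ fun i => (x i : ℝ) := by
    funext ℓ c
    exact bucketMatrix_mulVec g τ x ℓ c
  rw [← e] at h
  have hex : ∃ q : (Fin n → ℤ) × ℕ, IsIndex q.1 q.2 ∧
        θ * tailSum n (sortedSq q.1) q.2 ≤ q.2 * sortedSq q.1 q.2 ∧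
        Consistent n (3 * M) w ζ μ (fun (ℓ : Fin (w₁ + 1)) (c : Fin (2 ^ w₂)) =>
          (((bucketMatrix g τ).mulVec x (finProdFinEquiv (ℓ, c)) : ℤ) : ℝ)) (sortedSq q.1) :=
    ⟨(x, k), hk, hx, h⟩
  have hout : (bucketSketch key σ wordBits (3 * M) w ζ μ θ p).output x s =
      topMoment hex.choose.1 p hex.choose.2 := dif_pos hex
  obtain ⟨c1, c2, c3⟩ := hex.choose_spec
  rw [hout]
  generalize hex.choose = q at c1 c2 c3
  obtain ⟨x', k'⟩ := q
  dsimp only at c1 c2 c3 ⊢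
  have m1 := Consistent.moment_le hM hζ hζM hw hL hμ hμη hη hH hηH hθ hθ1 hηθ hηHθ hp0 hp2
    (hk.admissible hx) (c1.admissible c2) h c3
  have m2 := Consistent.moment_le hM hζ hζM hw hL hμ hμη hη hH hηH hθ hθ1 hηθ hηHθ hp0 hp2
    (c1.admissible c2) (hk.admissible hx) c3 h
  have hT : 0 ≤ topMoment x p k :=
    Finset.sum_nonneg fun i _ => Real.rpow_nonneg (abs_nonneg _) _
  have hz : (0 : ℝ) ≤ 16 / M := by positivity
  have g1 := mul_le_mul_of_nonneg_right hε hT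
  rw [abs_le]
  constructor
  -- The lower bound uses 1/(1 + z) ≥ 1 - z for z = 16/M.
  · have g2 : topMoment x p k * (1 - 16 / M) ≤ topMoment x' p k' := by
      have g3 : topMoment x p k * (1 - (16 / M) ^ 2) ≤ (1 + 16 / M) * topMoment x' p k' := by
        have : 0 ≤ topMoment x p k * (16 / M : ℝ) ^ 2 := by positivity
        linarith
      refine le_of_mul_le_mul_left ?_ (show (0 : ℝ) < 1 + 16 / M by linarith)
      refine le_trans (le_of_eq ?_) g3
      ring
    linarith
  · linarith

end Sketch

/-! ### Success probability, parameters and space. -/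

open Classical in
theorem one_sub_le_card_div {A C : ℕ} {δ : ℝ} {P : (Fin (A + C) → Bool) → Prop}
    {Q : (Fin A → Bool) × (Fin C → Bool) → Prop}
    (hQ : (#{s | ¬ Q s} : ℝ) ≤ δ * Fintype.card ((Fin A → Bool) × (Fin C → Bool)))
    (h : ∀ s, Q s → P (Fin.appendEquiv A C s)) :
    1 - δ ≤ (Nat.card {s // P s} : ℝ) / 2 ^ (A + C) := by
  have hcard : (Fintype.card ((Fin A → Bool) × (Fin C → Bool)) : ℝ) = 2 ^ (A + C) := by
    rw [Fintype.card_prod, Fintype.card_fun, Fintype.card_fun, pow_add]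
    simp only [Fintype.card_fin, Fintype.card_bool]
    push_cast
    rfl
  have h1 : (#{s | Q s} : ℝ) ≤ (Nat.card {s // P s} : ℝ) := by
    rw [← Fintype.card_subtype, ← Nat.card_eq_fintype_card]
    refine Nat.cast_le.2 (Nat.card_le_card_of_injective
      (fun s : {s // Q s} => (⟨Fin.appendEquiv A C s.1, h _ s.2⟩ : {s // P s})) ?_)
    intro s t hst
    exact Subtype.ext ((Fin.appendEquiv A C).injective (Subtype.ext_iff.1 hst))
  have h2 : (#{s | Q s} : ℝ) + #{s | ¬ Q s} =
      Fintype.card ((Fin A → Bool) × (Fin C → Bool)) := by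
    have := Finset.card_filter_add_card_filter_not (s := univ) Q
    rw [Finset.card_univ] at this
    exact_mod_cast this
  rw [hcard] at h2 hQ
  rw [le_div_iff₀ (by positivity)]
  linarith

theorem sum_inv_le {n : ℕ} (hn : 2 ≤ n) : ∑ j ∈ Icc 1 n, (1 : ℝ) / j ≤ 2 * Real.logb 2 n := by
  have h1 := harmonic_le_one_add_log n
  rw [harmonic_eq_sum_Icc] at h1
  push_cast at h1
  simp only [one_div]
  refine h1.trans ?_
  have hnr : (2 : ℝ) ≤ n := by exact_mod_cast hn
  have h2 : 1 ≤ Real.logb 2 n := by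
    rw [Real.le_logb_iff_rpow_le (by norm_num) (by linarith)]; simpa using hnr
  have h3 : Real.log n ≤ Real.logb 2 n := by
    rw [Real.logb, le_div_iff₀ (Real.log_pos (by norm_num))]
    have h4 : Real.log 2 ≤ 1 := by linarith [Real.log_two_lt_d9]
    have h5 : 0 ≤ Real.log n := Real.log_nonneg (by linarith)
    nlinarith
  linarith

/-- The number of samples by which the ranks of neighbouring thresholds differ. -/
def sampleGap (Λ D : ℕ) : ℕ := 300000 * Λ ^ 3 * D

/-- A number of buckets that suffices for all levels. -/
def bucketBound (C Λ D : ℕ) : ℕ :=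
  3072 * Λ * (96 * Λ * sampleGap Λ D) ^ 3 * (60000000 * Λ ^ C * Λ ^ 4) ^ 2 * D

/-- The two definitions above are tuned so that isolation and sampling each fail with probability at
most 1/(2D), with M = 32Λ and N = 3M = 96Λ. -/
theorem failure_le {C Λ D w₂ : ℕ} {η : ℝ} (hΛ : 1 ≤ Λ) (hD : 1 ≤ D)
    (hw₂ : bucketBound C Λ D ≤ 2 ^ w₂)
    (hη : η = 1 / (60000000 * (Λ : ℝ) ^ C * Λ ^ 4)) :
    ((Λ : ℝ) + 1) * (2 * ((3 * (32 * Λ) : ℕ) : ℝ) * (sampleGap Λ D : ℕ))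
        * (384 * (((3 * (32 * Λ) : ℕ) : ℝ) * (sampleGap Λ D : ℕ)) ^ 2 / (2 ^ w₂ * η ^ 2))
      + ((Λ : ℝ) + 1) * (2 * ((3 * (32 * Λ) : ℕ) : ℝ) + 2)
        * (2 * (2 * ((3 * (32 * Λ) : ℕ) : ℝ) + 1) / (sampleGap Λ D : ℕ)) ≤ 1 / D := by
  have hL : (1 : ℝ) ≤ Λ := by exact_mod_cast hΛ
  have hDr : (1 : ℝ) ≤ D := by exact_mod_cast hD
  have hw0 : (0 : ℝ) < (sampleGap Λ D : ℕ) := by unfold sampleGap; push_cast; positivity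
  have hB : (3072 * (Λ : ℝ) * (96 * Λ * (sampleGap Λ D : ℕ)) ^ 3 * (60000000 * (Λ : ℝ) ^ C * Λ ^ 4) ^ 2
      * D) ≤ 2 ^ w₂ := by
    have := (Nat.cast_le (α := ℝ)).2 hw₂
    unfold bucketBound at this
    push_cast at this ⊢
    exact this
  have hηinv : (60000000 * (Λ : ℝ) ^ C * Λ ^ 4) = 1 / η := by rw [hη, one_div_one_div]
  have hη0 : 0 < η := by rw [hη]; positivity
  rw [hηinv] at hB
  have e96 : ((3 * (32 * Λ) : ℕ) : ℝ) = 96 * Λ := by push_cast; ring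
  rw [e96]
  set W : ℝ := ((sampleGap Λ D : ℕ) : ℝ) with hW
  have p1 : ((Λ : ℝ) + 1) * (2 * (96 * Λ) * W) * (384 * (96 * Λ * W) ^ 2 / (2 ^ w₂ * η ^ 2)) ≤
      1 / (2 * D) := by
    rw [← mul_div_assoc, div_le_div_iff₀ (by positivity) (by positivity)]
    have h1 : 3072 * (Λ : ℝ) * (96 * Λ * W) ^ 3 * D ≤ 2 ^ w₂ * η ^ 2 := by
      have := mul_le_mul_of_nonneg_right hB (sq_nonneg η)
      refine le_trans (le_of_eq ?_) this
      field_simp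
    refine le_trans ?_ (h1.trans (one_mul _).ge)
    have h2 : ((Λ : ℝ) + 1) ≤ 2 * Λ := by linarith
    have h3 : 0 ≤ 1536 * (96 * Λ * W) ^ 3 * (D : ℝ) := by positivity
    have h4 := mul_le_mul_of_nonneg_right h2 h3
    linarith
  have p2 : ((Λ : ℝ) + 1) * (2 * (96 * Λ) + 2) * (2 * (2 * (96 * Λ) + 1) / W) ≤ 1 / (2 * D) := by
    rw [← mul_div_assoc, div_le_div_iff₀ hw0 (by positivity)]
    have h1 : ((Λ : ℝ) + 1) ≤ 2 * Λ := by linarith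
    have h2 : 2 * (96 * (Λ : ℝ)) + 2 ≤ 194 * Λ := by linarith
    have h3 : 2 * (2 * (96 * (Λ : ℝ)) + 1) ≤ 386 * Λ := by linarith
    calc ((Λ : ℝ) + 1) * (2 * (96 * Λ) + 2) * (2 * (2 * (96 * Λ) + 1)) * (2 * D)
        ≤ (2 * Λ) * (194 * Λ) * (386 * Λ) * (2 * D) := by gcongr
      _ ≤ 1 * W := by
        have : 0 ≤ (Λ : ℝ) ^ 3 * D := by positivity
        rw [hW, sampleGap]
        push_cast
        linarith
  have e : (1 : ℝ) / D = 1 / (2 * D) + 1 / (2 * D) := by field_simp; norm_num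
  rw [e]
  exact add_le_add p1 p2

theorem space_le {γ C Λ D : ℕ} (hΛ : 1 ≤ Λ) (hD : 1 ≤ D) :
    2 * (Λ + (Nat.log 2 (bucketBound C Λ D) + 1)) + 4 * (Λ + (Nat.log 2 (bucketBound C Λ D) + 1))
      + (Λ + 1) * 2 ^ (Nat.log 2 (bucketBound C Λ D) + 1) * ((γ + 1) * Λ + 2) ≤
      (2 * γ + 18) * (2 * (3072 * (96 * 300000) ^ 3 * 60000000 ^ 2 * D ^ 4)) * Λ ^ (2 * C + 23) := by
  set b := bucketBound C Λ D with hb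
  have hb0 : b ≠ 0 := by rw [hb]; unfold bucketBound sampleGap; positivity
  set w₂ := Nat.log 2 b + 1 with hw₂
  have hT : 2 ^ w₂ ≤ 2 * b := by
    rw [hw₂, pow_succ, mul_comm]
    -- Rounding the number of buckets up to a power of two at most doubles it.
    exact Nat.mul_le_mul_left 2 (Nat.pow_log_le_self 2 hb0)
  have hwT : w₂ ≤ 2 ^ w₂ := Nat.lt_two_pow_self.le
  have hT1 : 1 ≤ 2 ^ w₂ := Nat.one_le_two_pow
  clear_value w₂
  set T := 2 ^ w₂
  have h1 : 2 * (Λ + w₂) + 4 * (Λ + w₂) + (Λ + 1) * T * ((γ + 1) * Λ + 2) ≤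
      (2 * γ + 18) * Λ ^ 2 * T := by
    have a1 : Λ ≤ Λ ^ 2 * T := by
      calc Λ = Λ * 1 * 1 := by ring
        _ ≤ Λ * Λ * T := by gcongr
        _ = _ := by ring
    have a2 : w₂ ≤ Λ ^ 2 * T := by
      calc w₂ ≤ 1 ^ 2 * T := by omega
        _ ≤ _ := by gcongr
    have a3 : (Λ + 1) * T * ((γ + 1) * Λ + 2) ≤ (2 * Λ) * T * ((γ + 3) * Λ) := by
      gcongr
      · omega
      · have : (γ + 3) * Λ = (γ + 1) * Λ + 2 * Λ := by ring
        omega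
    calc _ ≤ 2 * (Λ ^ 2 * T + Λ ^ 2 * T) + 4 * (Λ ^ 2 * T + Λ ^ 2 * T)
          + (2 * Λ) * T * ((γ + 3) * Λ) := by gcongr
      _ = _ := by ring
  refine h1.trans ?_
  calc (2 * γ + 18) * Λ ^ 2 * T ≤ (2 * γ + 18) * Λ ^ 2 * (2 * b) := by gcongr
    _ = _ := by
      rw [hb]
      unfold bucketBound sampleGap
      ring

theorem exists_sketch {n m γ C Λ D : ℕ} {ε p : ℝ} (hΛ : 1 ≤ Λ) (hD : 1 ≤ D) (hn : n ≤ 2 ^ Λ)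
    (hH : ∑ j ∈ Icc 1 n, (1 : ℝ) / j ≤ 2 * Λ) (hm : m ≤ n ^ γ) (hε : 1 ≤ ε * Λ)
    (hp0 : 0 ≤ p) (hp2 : p ≤ 2) :
    ∃ S : LinearSketch n, S.FitsOn m ∧
      S.space ≤ (2 * γ + 18) * (2 * (3072 * (96 * 300000) ^ 3 * 60000000 ^ 2 * D ^ 4))
        * Λ ^ (2 * C + 23) ∧
      ∀ (x : Fin n → ℤ) (k : ℕ), IsIndex x k →
        1 / (3 * (Λ : ℝ) ^ C) * tailSum n (sortedSq x) k ≤ k * sortedSq x k →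
        S.successProb x ε (topMoment x p k) ≥ 1 - 1 / D := by
  classical
  have hL : (1 : ℝ) ≤ Λ := by exact_mod_cast hΛ
  have hL0 : (0 : ℝ) < Λ := by linarith
  set Q : ℝ := (Λ : ℝ) ^ C with hQ
  have hQ1 : 1 ≤ Q := one_le_pow₀ hL
  have hQ0 : 0 < Q := by linarith
  set w₂ := Nat.log 2 (bucketBound C Λ D) + 1 with hw₂
  have hB : bucketBound C Λ D ≤ 2 ^ w₂ := (Nat.lt_pow_succ_log_self (by norm_num) _).le
  obtain ⟨key, σ, hkey, hσ⟩ := exists_families Λ w₂ n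
    (hn.trans (Nat.pow_le_pow_right (by norm_num) (by omega))) (by omega)
  -- Here 3ζ = 1/M, so (1 + ζ)² ≤ 1 + 1/M; the factor 200Λ in η covers 2(1 + 1/ζ) = 2(1 + 96Λ); and
  -- η₀ is small enough for η to beat θ with the harmonic bound 2Λ and M².
  set ζ : ℝ := 1 / (96 * Λ) with hζ
  set η₀ : ℝ := 1 / (60000000 * Q * (Λ : ℝ) ^ 4) with hη₀
  set μ : ℝ := (1 + 1 / ζ) * η₀ with hμ
  set θ : ℝ := 1 / (3 * Q) with hθ
  set η : ℝ := 200 * Λ * η₀ with hη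
  have hζ0 : 0 < ζ := by positivity
  have hζ1 : ζ ≤ 1 := by rw [hζ, div_le_one (by positivity)]; linarith
  have hη₀0 : 0 < η₀ := by positivity
  have hL4 : 1 ≤ (Λ : ℝ) ^ 4 := one_le_pow₀ hL
  have hη₀1 : η₀ ≤ 1 := by
    rw [hη₀, div_le_one (by positivity)]
    nlinarith [mul_le_mul hQ1 hL4 (by norm_num) hQ0.le]
  have hw : 1 ≤ sampleGap Λ D := by
    unfold sampleGap
    exact Nat.mul_pos (Nat.mul_pos (by norm_num) (by positivity)) hD
  have hμ0 : 0 ≤ μ := by positivity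
  have cM : (((32 * Λ : ℕ)) : ℝ) = 32 * Λ := by push_cast; ring
  have hζM : (1 + ζ) ^ 2 ≤ 1 + 1 / ((32 * Λ : ℕ) : ℝ) := by
    have : 1 / ((32 * Λ : ℕ) : ℝ) = 3 * ζ := by rw [cM, hζ]; field_simp; norm_num
    rw [this]
    nlinarith
  have hμη : 2 * μ ≤ η := by
    rw [hμ, hη, hζ, one_div_one_div]
    have : 2 * (1 + 96 * (Λ : ℝ)) ≤ 200 * Λ := by linarith
    have := mul_le_mul_of_nonneg_right this hη₀0.le
    linarith
  have hη0 : 0 ≤ η := by positivity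
  have hθ0 : 0 < θ := by positivity
  have hθ1 : θ ≤ 1 := by rw [hθ, div_le_one (by positivity)]; linarith
  have hηeq : η * (300000 * Q * (Λ : ℝ) ^ 3) = 1 := by rw [hη, hη₀]; field_simp; norm_num
  have hL3 : 1 ≤ (Λ : ℝ) ^ 3 := one_le_pow₀ hL
  have hηH : η * (2 * Λ) ≤ 1 / 4 := by
    have h1 : 8 * (Λ : ℝ) ≤ 300000 * Q * (Λ : ℝ) ^ 3 := by
      have : (Λ : ℝ) ≤ (Λ : ℝ) ^ 3 := le_self_pow₀ hL (by norm_num)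
      nlinarith
    have := mul_le_mul_of_nonneg_left h1 hη0
    linarith
  -- 86016 = 42 · 2 · 32² comes from the condition on η·H·M².
  have hbase : 86016 * η * (Λ : ℝ) ^ 3 ≤ θ := by
    rw [hθ, le_div_iff₀ (by positivity)]
    have : 0 ≤ η * Q * (Λ : ℝ) ^ 3 := by positivity
    linarith
  have hηθ : 7 * η * ((32 * Λ : ℕ) : ℝ) ≤ θ := by
    rw [cM]
    refine le_trans ?_ hbase
    have : (Λ : ℝ) ≤ (Λ : ℝ) ^ 3 := le_self_pow₀ hL (by norm_num)
    have := mul_le_mul_of_nonneg_left this hη0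
    nlinarith
  have hηHθ : 42 * η * (2 * Λ) * ((32 * Λ : ℕ) : ℝ) ^ 2 ≤ θ := by
    rw [cM]
    refine le_trans (le_of_eq ?_) hbase
    ring
  have hN : 2 * (3 * (32 * Λ)) * sampleGap Λ D ≤ 2 ^ w₂ := by
    refine le_trans ?_ hB
    unfold bucketBound
    have g1 : 1 ≤ 96 * Λ * sampleGap Λ D := Nat.mul_pos (Nat.mul_pos (by norm_num) hΛ) hw
    have g2 : 1 ≤ (60000000 * Λ ^ C * Λ ^ 4) ^ 2 := Nat.one_le_iff_ne_zero.2 (by positivity)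
    calc 2 * (3 * (32 * Λ)) * sampleGap Λ D = 2 * 1 * (96 * Λ * sampleGap Λ D) ^ 1 * 1 * 1 := by ring
      _ ≤ _ := by gcongr <;> norm_num
  refine ⟨bucketSketch key σ ((γ + 1) * Λ + 2) (3 * (32 * Λ)) (sampleGap Λ D) ζ μ θ p,
    bucketSketch_fitsOn hσ.mul_self hn hm, space_le hΛ hD, fun x k hk hx => ?_⟩
  have hprob := card_not_consistent hkey hσ x hζ0 hζ1 hη₀0 hη₀1 hμ hw hN
    (failure_le hΛ hD hB hη₀)
  refine one_sub_le_card_div hprob fun s hs => ?_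
  refine bucketSketch_output (by omega) hζ0.le hζM hw hn hμ0 hμη hη0 hH hηH hθ0 hθ1 hηθ hηHθ hp0 hp2
    ?_ hk hx _ ?_
  · rw [cM, div_le_iff₀ (by positivity)]
    linarith
  · rw [Equiv.symm_apply_apply]
    exact hs

end TrimmedSketch

/-! ### Choice of Λ, C and D for the given constants. -/

theorem corollary9 (c : ℝ) :
    ∃ d : ℕ, ∀ (γ : ℕ) (δ : ℝ), 0 < δ → δ < 1 → ∃ K : ℝ,
      ∀ (n m : ℕ) (ε p : ℝ), 2 ≤ n → m ≤ n ^ γ → 0 < ε → ε < 1 → 0 ≤ p → p ≤ 2 →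
        ∃ S : TrimmedSketch.LinearSketch n,
          S.FitsOn m ∧
          (S.space : ℝ) ≤ K * (Real.logb 2 n / ε) ^ d ∧
          ∀ (x : Fin n → ℤ) (k : ℕ), (∀ i, |x i| ≤ (m : ℤ)) → TrimmedSketch.IsIndex x k →
            (TrimmedSketch.sorted x ⌊(1 + ε) * (k : ℝ)⌋₊ : ℝ) ^ 2 ≥
              (ε / Real.logb 2 n) ^ c *
                ((TrimmedSketch.residualSq x ⌊(1 + ε) * (k : ℝ)⌋₊ : ℝ) / ((1 + ε) * (k : ℝ))) →
            S.successProb x ε (TrimmedSketch.topMoment x p k) ≥ 1 - δ := by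
  -- The exponent is the power of Λ in the space bound: 2C + 8 from 1/η₀², 12 from the cubed range
  -- of thresholds, 1 from the other factor Λ in the number of buckets, and 2 from levels and word
  -- length.
  refine ⟨2 * ⌈c⌉₊ + 23, fun γ δ hδ _ => ?_⟩
  set C := ⌈c⌉₊ with hC
  set D := ⌈1 / δ⌉₊ with hDdef
  have hDδ : 1 / δ ≤ D := Nat.le_ceil _
  have hD : 1 ≤ D := Nat.one_le_iff_ne_zero.2 (Nat.ceil_pos.2 (by positivity)).ne'
  refine ⟨(2 * γ + 18) * (2 * (3072 * (96 * 300000) ^ 3 * 60000000 ^ 2 * D ^ 4)) * 2 ^ (2 * C + 23),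
    fun n m ε p hn hm hε hε1 hp0 hp2 => ?_⟩
  have hnr : (2 : ℝ) ≤ n := by exact_mod_cast hn
  have hlog : 1 ≤ Real.logb 2 n := by
    rw [Real.le_logb_iff_rpow_le (by norm_num) (by linarith)]; simpa using hnr
  set r := Real.logb 2 n / ε with hr
  have hrlog : Real.logb 2 n ≤ r := by rw [hr, le_div_iff₀ hε]; nlinarith
  have hr1 : 1 ≤ r := hlog.trans hrlog
  set Λ := ⌈r⌉₊ with hΛdef
  have hrΛ : r ≤ Λ := Nat.le_ceil _
  have hΛr : (Λ : ℝ) ≤ 2 * r := by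
    have := Nat.ceil_lt_add_one (show 0 ≤ r by linarith)
    linarith
  have hL : (1 : ℝ) ≤ Λ := hr1.trans hrΛ
  have hΛ : 1 ≤ Λ := by exact_mod_cast hL
  have hn2 : n ≤ 2 ^ Λ := by
    have h1 : (n : ℝ) ≤ 2 ^ (Λ : ℝ) := by
      rw [← Real.logb_le_iff_le_rpow (by norm_num) (by linarith)]
      exact hrlog.trans hrΛ
    rw [Real.rpow_natCast] at h1
    exact_mod_cast h1
  have hεr : ε * r = Real.logb 2 n := by rw [hr]; field_simp
  have hεΛ : 1 ≤ ε * Λ := by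
    have := mul_le_mul_of_nonneg_left hrΛ hε.le
    linarith
  obtain ⟨S, hfit, hspace, hS⟩ := TrimmedSketch.exists_sketch (C := C) hΛ hD hn2
    ((TrimmedSketch.sum_inv_le hn).trans (by linarith)) hm hεΛ hp0 hp2
  refine ⟨S, hfit, ?_, fun x k _ hk hheavy => ?_⟩
  · have h1 : (S.space : ℝ) ≤ (2 * γ + 18) * (2 * (3072 * (96 * 300000) ^ 3 * 60000000 ^ 2 * D ^ 4))
        * (Λ : ℝ) ^ (2 * C + 23) := by exact_mod_cast hspace
    refine h1.trans ?_
    rw [mul_assoc _ ((2 : ℝ) ^ (2 * C + 23)), ← mul_pow]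
    gcongr
  -- The base ε / log₂ n is at most 1, so rounding c up to a natural number only weakens the
  -- condition; a negative c is rounded to 0.
  · have hbase : (1 / (Λ : ℝ)) ^ C ≤ (ε / Real.logb 2 n) ^ c := by
      have h0 : ε / Real.logb 2 n = 1 / r := by rw [hr, one_div_div]
      have hr0 : 0 < 1 / r := by positivity
      have hr2 : 1 / r ≤ 1 := by rw [div_le_one (by linarith)]; exact hr1
      rw [h0]
      calc (1 / (Λ : ℝ)) ^ C ≤ (1 / r) ^ C := by gcongr
        _ = (1 / r) ^ (C : ℝ) := (Real.rpow_natCast _ _).symm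
        _ ≤ (1 / r) ^ c := Real.rpow_le_rpow_of_exponent_ge hr0 hr2 (Nat.le_ceil c)
    have htail := TrimmedSketch.tailSum_le_of_heavy hk hε hε1 (by positivity)
      (pow_le_one₀ (by positivity) (by rw [div_le_one (by linarith)]; exact hL)) hbase hheavy
    have he : (1 / (Λ : ℝ)) ^ C / 3 = 1 / (3 * (Λ : ℝ) ^ C) := by
      rw [one_div_pow, div_div, mul_comm]
    rw [he] at htail
    refine le_trans ?_ (hS x k hk htail)
    have : 1 / (D : ℝ) ≤ δ := by
      rw [div_le_iff₀ (by positivity)]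
      rw [div_le_iff₀ hδ] at hDδ
      linarith
    linarith
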